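/- Let $n,d\ge 1$ and let $\mathcal W$ be a classical-quantum channel assigning to each $j\in\{1,\dots,n\}$ a density matrix $\mathcal W(j)\in\mathbb C^{d\times d}$ (positive semidefinite, trace one). Let $\Delta_n$ be the probability simplex in $\mathbb R^n$, and for $\alpha\in[1/2,1)$ put $$\tilde g(p)=\mathrm{Tr}\Big[\Big(\sum_{j=1}^n p[j]\,\mathcal W(j)^{\alpha}\Big)^{1/\alpha}\Big],\qquad g(p)=-I^{\mathrm R}_\alpha(p,\mathcal W)=\frac{\alpha}{1-\alpha}\log \tilde g(p),\qquad C_{\mathcal W,\alpha}=-\min_{p\in\Delta_n} g(p),$$ where $I^{\mathrm R}_\alpha$ is the Petz-Rényi information. Run the following universal fast gradient method of Nesterov on $\min_{p\in\Delta_n}\tilde g(p)$ for $T\ge1$ iterations with tolerance $\varepsilon=\log(n)^{0.5/\alpha}\,T^{1-1.5/\alpha}$. Let $h(p)=\langle p,\log p\rangle$, let $B_h(y,x)=h(y)-h(x)-\langle\nabla h(x),y-x\rangle$, and write $\odot$ for the coordinatewise product. Start from $p_1=\mathbf 1_n/n$, $A_1=0$, $L_1=1$, $\phi_1(p)=B_h(p,p_1)$.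 For $t=1,\dots,T$: 1. Let $q_t=\arg\min_{p\in\Delta_n}\phi_t(p)$. 2. For $i=0,1,2,\dots$ let $a_i>0$ be the positive root of $2^iL_ta^2=A_t+a$, that is, $a_i=\frac{1+\sqrt{1+2^{i+2}L_tA_t}}{2^{i+1}L_t}$, and let $\tau_i=\frac{a_i}{A_t+a_i}$, $x_i=\tau_iq_t+(1-\tau_i)p_t$, $\hat p_i=\frac{q_t\odot\exp(-a_i\nabla\tilde g(x_i))}{\|q_t\odot\exp(-a_i\nabla\tilde g(x_i))\|_1}$ and $y_i=\tau_i\hat p_i+(1-\tau_i)p_t$. Let $i_t$ be the first $i$ with $$\tilde g(y_i)\le\tilde g(x_i)+\langle\nabla\tilde g(x_i),y_i-x_i\rangle+2^{i-1}L_t\|y_i-x_i\|_1^2+\tfrac{\varepsilon}{2}\tau_i .$$ 3. With $i=i_t$ set $p_{t+1}=y_i$, $A_{t+1}=A_t+a_i$, $L_{t+1}=2^{i-1}L_t$, $\phi_{t+1}(p)=\phi_t(p)+a_i\langle\nabla\tilde g(x_i),p\rangle$. Then $\tilde g$ is differentiable (relative to the nonnegative orthant) at every point of $\Delta_n$, the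 minimum defining $C_{\mathcal W,\alpha}$ is attained, the method is well defined (in particular every line search stops), its output $p_{T+1}$ lies in $\Delta_n$, and $$g(p_{T+1})-\min_{p\in\Delta_n}g(p)\le C\cdot T^{1-1.5/\alpha},\qquad C=O\!\left(\frac{\log(n)^{0.5/\alpha}\exp\big((1/\alpha-1)\,C_{\mathcal W,\alpha}\big)}{1-\alpha}\right),$$ where the constant hidden in $O(\cdot)$ is absolute: it does not depend on $n,d,\mathcal W,\alpha$ or $T$. (For $n=1$ one has $\varepsilon=0$, and the error is $0$.) -/

import Mathlib

open Real
open scoped ComplexOrder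

/-! ### Classical-quantum channels and the Petz-Rényi information -/

/-- Quantum states on `ℂ^d`: positive semidefinite matrices of trace one. -/
def IsDensityMatrix {d : ℕ} (ρ : Matrix (Fin d) (Fin d) ℂ) : Prop :=
  ρ.PosSemidef ∧ ρ.trace = 1

/-- The real power `X ^ r` of a Hermitian matrix, through its spectral decomposition. -/
noncomputable def matPow {d : ℕ} (X : Matrix (Fin d) (Fin d) ℂ) (r : ℝ) :
    Matrix (Fin d) (Fin d) ℂ :=
  cfc (fun x : ℝ => x ^ r) X

/-- The exponentiated Rényi objective `Tr[(∑ j, p[j] W(j)^α)^(1/α)]`. -/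
noncomputable def expRenyi {n d : ℕ} (α : ℝ) (W : Fin n → Matrix (Fin d) (Fin d) ℂ)
    (p : Fin n → ℝ) : ℝ :=
  (matPow (∑ j, p j • matPow (W j) α) (1 / α)).trace.re

/-- The Petz-Rényi information of order `α`. -/
noncomputable def petzRenyiInfo {n d : ℕ} (α : ℝ) (W : Fin n → Matrix (Fin d) (Fin d) ℂ)
    (p : Fin n → ℝ) : ℝ :=
  α / (α - 1) * log (matPow (∑ j, p j • matPow (W j) α) (1 / α)).trace.re

/-- The negative Petz-Rényi information. -/
noncomputable def negRenyiInfo {n d : ℕ} (α : ℝ) (W : Fin n → Matrix (Fin d) (Fin d) ℂ)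
    (p : Fin n → ℝ) : ℝ :=
  -petzRenyiInfo α W p

/-- The minimum of the negative Petz-Rényi information over the probability simplex. -/
noncomputable def minNegRenyiInfo {n d : ℕ} (α : ℝ) (W : Fin n → Matrix (Fin d) (Fin d) ℂ) : ℝ :=
  sInf (negRenyiInfo α W '' stdSimplex ℝ (Fin n))

/-- The Petz-Augustin capacity of order `α`. -/
noncomputable def capacity {n d : ℕ} (α : ℝ) (W : Fin n → Matrix (Fin d) (Fin d) ℂ) : ℝ :=
  -minNegRenyiInfo α W

/-! ### Ingredients of the universal fast gradient method -/

/-- The `ℓ₁` norm of a vector. -/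
def l1Norm {n : ℕ} (x : Fin n → ℝ) : ℝ := ∑ j, |x j|

/-- The gradient of `f` relative to the nonnegative orthant. The orthant is convex with nonempty
interior, so where `f` is differentiable relative to it the gradient is unique; at points of the
boundary it does not depend on how `f` is extended to vectors with negative coordinates. -/
noncomputable def orthantGrad {n : ℕ} (f : (Fin n → ℝ) → ℝ) (p : Fin n → ℝ) : Fin n → ℝ :=
  fun j => fderivWithin ℝ f (Set.Ici 0) p (Pi.single j 1)

/-- The negative Shannon entropy `h(p) = ⟨p, log p⟩`. -/
noncomputable def negEntropy {n : ℕ} (p : Fin n → ℝ) : ℝ := ∑ j, p j * log (p j)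

/-- The Bregman divergence `B_h(y, x) = h(y) - h(x) - ⟨∇h(x), y - x⟩`. -/
noncomputable def bregman {n : ℕ} (h : (Fin n → ℝ) → ℝ) (y x : Fin n → ℝ) : ℝ :=
  h y - h x - fderiv ℝ h x (y - x)

/-- The entropic mirror descent step `z ⊙ exp(-η v) / ‖z ⊙ exp(-η v)‖₁`. -/
noncomputable def entropicStep {n : ℕ} (z v : Fin n → ℝ) (η : ℝ) : Fin n → ℝ :=
  fun j => z j * exp (-(η * v j)) / l1Norm (fun k => z k * exp (-(η * v k)))

/-- What the method carries from one iteration to the next: the iterate `p_t`, the scalars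
`A_t` and `L_t`, and the estimating function `φ_t`. -/
structure FGMState (n : ℕ) where
  p : Fin n → ℝ
  A : ℝ
  L : ℝ
  φ : (Fin n → ℝ) → ℝ

namespace FGMState

variable {n : ℕ}

/-- The initial state: `p₁` is the uniform distribution, `A₁ = 0`, `L₁ = 1`,
`φ₁ = B_h(·, p₁)`. -/
noncomputable def init (n : ℕ) : FGMState n where
  p := fun _ => 1 / (n : ℝ)
  A := 0
  L := 1
  φ := fun x => bregman negEntropy x (fun _ => 1 / (n : ℝ))

/-- The trial coefficient `a_{t+1,i}`: the positive root of `2^i L_t a² = A_t + a`. -/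
noncomputable def trialCoeff (s : FGMState n) (i : ℕ) : ℝ :=
  (1 + sqrt (1 + 2 ^ (i + 2) * s.L * s.A)) / (2 ^ (i + 1) * s.L)

/-- `τ_{t,i} = a_{t+1,i} / A_{t+1,i}` with `A_{t+1,i} = A_t + a_{t+1,i}`. -/
noncomputable def trialWeight (s : FGMState n) (i : ℕ) : ℝ :=
  s.trialCoeff i / (s.A + s.trialCoeff i)

/-- The trial extrapolation point `τ q + (1 - τ) p_t`. -/
noncomputable def trialMid (s : FGMState n) (q : Fin n → ℝ) (i : ℕ) : Fin n → ℝ :=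
  s.trialWeight i • q + (1 - s.trialWeight i) • s.p

/-- The trial iterate `τ p̂ + (1 - τ) p_t`, where `p̂` is an entropic mirror descent step from `q`
along the gradient at the extrapolation point. -/
noncomputable def trialNext (f : (Fin n → ℝ) → ℝ) (s : FGMState n) (q : Fin n → ℝ) (i : ℕ) :
    Fin n → ℝ :=
  s.trialWeight i • entropicStep q (orthantGrad f (s.trialMid q i)) (s.trialCoeff i)
    + (1 - s.trialWeight i) • s.p

/-- The acceptance test of the line search; `2 ^ i / 2` is `2^(i-1)`. -/
def Accept (f : (Fin n → ℝ) → ℝ) (ε : ℝ) (s : FGMState n) (q : Fin n → ℝ) (i : ℕ) : Prop :=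
  f (s.trialNext f q i) ≤ f (s.trialMid q i)
    + orthantGrad f (s.trialMid q i) ⬝ᵥ (s.trialNext f q i - s.trialMid q i)
    + 2 ^ i / 2 * s.L * l1Norm (s.trialNext f q i - s.trialMid q i) ^ 2
    + ε / 2 * s.trialWeight i

/-- The state after the iteration in which the trial `i` has been accepted. -/
noncomputable def update (f : (Fin n → ℝ) → ℝ) (s : FGMState n) (q : Fin n → ℝ) (i : ℕ) :
    FGMState n where
  p := s.trialNext f q i
  A := s.A + s.trialCoeff i
  L := 2 ^ i / 2 * s.L
  φ := fun x => s.φ x + s.trialCoeff i * (orthantGrad f (s.trialMid q i) ⬝ᵥ x)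

/-- One iteration: `q` minimizes `φ_t` over the simplex, and `i` is the first trial that passes
the acceptance test. -/
def Step (f : (Fin n → ℝ) → ℝ) (ε : ℝ) (s s' : FGMState n) : Prop :=
  ∃ q ∈ stdSimplex ℝ (Fin n), IsMinOn s.φ (stdSimplex ℝ (Fin n)) q ∧
    ∃ i : ℕ, s.Accept f ε q i ∧ (∀ k < i, ¬ s.Accept f ε q k) ∧ s' = s.update f q i

end FGMState

/-- `s 1, …, s (T + 1)` are the states of a run of `T` iterations of the universal fast gradient
method for minimizing `f` over the probability simplex with error tolerance `ε`. -/
def IsFGMRun {n : ℕ} (f : (Fin n → ℝ) → ℝ) (ε : ℝ) (T : ℕ) (s : ℕ → FGMState n) : Prop :=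
  s 1 = FGMState.init n ∧ ∀ t, 1 ≤ t → t ≤ T → FGMState.Step f ε (s t) (s (t + 1))

/-- The error tolerance `log(n)^(0.5/α) T^(1-1.5/α)`. -/
noncomputable def fgmTolerance (n T : ℕ) (α : ℝ) : ℝ :=
  log n ^ (0.5 / α) * (T : ℝ) ^ (1 - 1.5 / α)

/-! ### Trace inequalities for functional calculus: Klein's inequality and resolvents -/

section MatrixTrace

variable {m : Type*} [Fintype m] [DecidableEq m] {A B : Matrix m m ℂ}

open Matrix
open scoped MatrixOrder

/-! Write `f` for the exponentiated objective and set r = 1/α = 2/(1+β) with β = 2α-1 in [0,1), ν =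
r-1 in (0,1].

The analytic core is that `f` is convex and Hölder smooth in the ℓ₁ norm with constants free of n, d
and the channel: f(y) ≤ f(x) + ⟨∇f(x), y-x⟩ + r‖y-x‖₁^r. Convexity is Klein's inequality. For
smoothness, put z = min(x,y) coordinatewise, so that the matrices at x and y are Z+N and Z+P with Z,
N, P positive semidefinite. Passing from Z+N to Z+P through Z, the error reduces to the estimate
Tr[((A+B)^ν - A^ν)B] ≤ Tr B^(ν+1) (`trace_rpow_add_sub_mul_le`) and to monotonicity of x^ν
(`trace_rpow_add_mul_ge`); both follow from an integral of resolvents. The remaining traces are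
values of `f` at x-z and y-z, and `expRenyi_le_sum_rpow` bounds them by powers of ℓ₁ norms.

The second half is Nesterov's estimating-sequence argument with entropy. Every φ_t is entropy plus
an affine function, its minimizer is a Gibbs distribution, and Pinsker's inequality supplies strong
convexity. `Invariant.update` then yields f(p_t) - f(p) ≤ log n / A_t + ε/2 whenever A_t > 0. A
trial can be rejected only if its smoothness estimate is small (`rejected_bound`), which bounds L_t
by a power of A_t and makes A_t^(1/(2-β)) grow at least linearly (`rpow_growth`). The tolerance is
the solution of log n = ε^(1+β) T^(2-β), which turns log n / A into a multiple of ε.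

Finally log u ≤ u - 1 transfers the bound to the Rényi information; the factor 1/f(p⋆) at a
minimizer p⋆ is exp((1/α-1)C). -/

theorem trace_cfc_mul_re (hA : A.IsHermitian) (f : ℝ → ℝ) (B : Matrix m m ℂ) :
    (cfc f A * B).trace.re = ∑ i, f (hA.eigenvalues i) *
      ((star (hA.eigenvectorUnitary : Matrix m m ℂ) * B * hA.eigenvectorUnitary) i i).re := by
  rw [hA.cfc_eq, IsHermitian.cfc, Unitary.conjStarAlgAut_apply, mul_assoc, mul_assoc,
    trace_mul_comm, mul_assoc, trace, Complex.re_sum]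
  refine Finset.sum_congr rfl fun i _ => ?_
  rw [diag_apply, diagonal_mul]
  simp [mul_assoc]

/-- The squared overlaps of two eigenbases. -/
noncomputable def eigenOverlap (hA : A.IsHermitian) (hB : B.IsHermitian) (i j : m) : ℝ :=
  Complex.normSq ((star (hA.eigenvectorUnitary : Matrix m m ℂ) * hB.eigenvectorUnitary) i j)

theorem eigenOverlap_nonneg (hA : A.IsHermitian) (hB : B.IsHermitian) (i j : m) :
    0 ≤ eigenOverlap hA hB i j := Complex.normSq_nonneg _

/-- Expanding in the two eigenbases turns traces into sums with nonnegative weights, so trace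
inequalities reduce to scalar inequalities between pairs of eigenvalues, even for matrices that do
not commute. -/
theorem trace_cfc_mul_cfc_re (hA : A.IsHermitian) (hB : B.IsHermitian) (f g : ℝ → ℝ) :
    (cfc f A * cfc g B).trace.re =
      ∑ i, ∑ j, f (hA.eigenvalues i) * g (hB.eigenvalues j) * eigenOverlap hA hB i j := by
  rw [trace_cfc_mul_re hA]
  refine Finset.sum_congr rfl fun i _ => ?_
  set U : Matrix m m ℂ := (hA.eigenvectorUnitary : Matrix m m ℂ)
  set V : Matrix m m ℂ := (hB.eigenvectorUnitary : Matrix m m ℂ) with hV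
  have : star U * cfc g B * U =
      (star U * V) * diagonal (RCLike.ofReal ∘ g ∘ hB.eigenvalues) * star (star U * V) := by
    rw [hB.cfc_eq, IsHermitian.cfc, Unitary.conjStarAlgAut_apply, star_mul, star_star]
    simp only [mul_assoc, hV]
  rw [this, mul_apply, Complex.re_sum, Finset.mul_sum]
  refine Finset.sum_congr rfl fun j _ => ?_
  rw [mul_diagonal, star_apply, eigenOverlap, mul_assoc (f _)]
  congr 1
  rw [mul_right_comm, RCLike.star_def, Complex.mul_conj]
  simp [mul_comm, U, V]

theorem trace_cfc_re (hA : A.IsHermitian) (hB : B.IsHermitian) (f : ℝ → ℝ) :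
    (cfc f A).trace.re = ∑ i, ∑ j, f (hA.eigenvalues i) * eigenOverlap hA hB i j := by
  have := trace_cfc_mul_cfc_re hA hB f (fun _ => 1)
  rw [cfc_const_one ℝ B, mul_one] at this
  simpa using this

theorem trace_cfc_re' (hA : A.IsHermitian) (hB : B.IsHermitian) (f : ℝ → ℝ) :
    (cfc f B).trace.re = ∑ i, ∑ j, f (hB.eigenvalues j) * eigenOverlap hA hB i j := by
  have := trace_cfc_mul_cfc_re hA hB (fun _ => 1) f
  rw [cfc_const_one ℝ A, one_mul] at this
  simpa using this

theorem continuousOn_spectrum (A : Matrix m m ℂ) (f : ℝ → ℝ) : ContinuousOn f (spectrum ℝ A) :=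
  A.finite_real_spectrum.continuousOn f

/-- **Klein's inequality**. -/
theorem klein_inequality (hA : A.IsHermitian) (hB : B.IsHermitian) (φ ψ : ℝ → ℝ)
    (h : ∀ i j, φ (hA.eigenvalues i) +
      ψ (hA.eigenvalues i) * (hB.eigenvalues j - hA.eigenvalues i) ≤ φ (hB.eigenvalues j)) :
    (cfc φ A).trace.re + (cfc ψ A * (B - A)).trace.re ≤ (cfc φ B).trace.re := by
  have h1 : (cfc ψ A * B).trace.re =
      ∑ i, ∑ j, ψ (hA.eigenvalues i) * hB.eigenvalues j * eigenOverlap hA hB i j := by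
    rw [← trace_cfc_mul_cfc_re hA hB ψ (fun x => x), cfc_id' ℝ B hB.isSelfAdjoint]
  have h2 : (cfc ψ A * A).trace.re =
      ∑ i, ∑ j, ψ (hA.eigenvalues i) * hA.eigenvalues i * eigenOverlap hA hB i j := by
    rw [← trace_cfc_re hA hB (fun x => ψ x * x),
      cfc_mul ψ (fun x => x) A (continuousOn_spectrum A _) (continuousOn_spectrum A _),
      cfc_id' ℝ A hA.isSelfAdjoint]
  rw [mul_sub, trace_sub, Complex.sub_re, h1, h2, trace_cfc_re hA hB φ, trace_cfc_re' hA hB φ]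
  simp only [← Finset.sum_sub_distrib, ← Finset.sum_add_distrib]
  refine Finset.sum_le_sum fun i _ => Finset.sum_le_sum fun j _ => ?_
  have := mul_le_mul_of_nonneg_right (h i j) (eigenOverlap_nonneg hA hB i j)
  linarith

theorem trace_mul_re_nonneg (hA : A.PosSemidef) (hB : B.PosSemidef) : 0 ≤ (A * B).trace.re := by
  obtain ⟨C, rfl⟩ := CStarAlgebra.nonneg_iff_eq_star_mul_self.mp hB.nonneg
  rw [← mul_assoc, trace_mul_comm, ← mul_assoc]
  exact (Complex.nonneg_iff.mp (hA.mul_mul_conjTranspose_same C).trace_nonneg).1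

theorem posSemidef_cfc (f : ℝ → ℝ) (hf : ∀ x, 0 ≤ x → 0 ≤ f x) (hA : A.PosSemidef) :
    (cfc f A).PosSemidef :=
  nonneg_iff_posSemidef.mp <| cfc_nonneg fun x hx =>
    hf x (spectrum_nonneg_of_nonneg hA.nonneg hx)

/-- The resolvent `(t + A)⁻¹`, through the functional calculus. -/
noncomputable def resolventAt (t : ℝ) (A : Matrix m m ℂ) : Matrix m m ℂ :=
  cfc (fun x : ℝ => (t + x)⁻¹) A

theorem posSemidef_resolventAt {t : ℝ} (ht : 0 < t) (hA : A.PosSemidef) :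
    (resolventAt t A).PosSemidef :=
  posSemidef_cfc _ (fun x hx => by positivity) hA

theorem resolventAt_mul {t : ℝ} (ht : 0 < t) (hA : A.PosSemidef) :
    resolventAt t A * (t • 1 + A) = 1 := by
  have h : (t • 1 + A : Matrix m m ℂ) = cfc (fun x : ℝ => t + x) A := by
    rw [cfc_const_add t (fun x => x) A (continuousOn_spectrum A _) hA.1.isSelfAdjoint,
      cfc_id' ℝ A hA.1.isSelfAdjoint, Algebra.algebraMap_eq_smul_one]
  rw [h, resolventAt, ← cfc_mul _ _ A (continuousOn_spectrum A _) (continuousOn_spectrum A _),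
    ← cfc_const_one ℝ A hA.1.isSelfAdjoint]
  refine cfc_congr fun x hx => ?_
  have := spectrum_nonneg_of_nonneg hA.nonneg hx
  exact inv_mul_cancel₀ (by positivity)

theorem mul_resolventAt {t : ℝ} (ht : 0 < t) (hA : A.PosSemidef) :
    (t • 1 + A) * resolventAt t A = 1 :=
  mul_eq_one_comm.mp (resolventAt_mul ht hA)

theorem resolventAt_sub {t : ℝ} (ht : 0 < t) (hA : A.PosSemidef) (hB : B.PosSemidef) :
    resolventAt t A - resolventAt t (A + B) = resolventAt t A * B * resolventAt t (A + B) := by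
  have h1 := resolventAt_mul ht hA
  have h2 := mul_resolventAt ht (hA.add hB)
  calc _ = resolventAt t A * ((t • 1 + (A + B)) * resolventAt t (A + B))
        - (resolventAt t A * (t • 1 + A)) * resolventAt t (A + B) := by rw [h1, h2]; simp
    _ = _ := by noncomm_ring

theorem resolventAt_sub' {t : ℝ} (ht : 0 < t) (hA : A.PosSemidef) (hB : B.PosSemidef) :
    resolventAt t A - resolventAt t (A + B) = resolventAt t (A + B) * B * resolventAt t A := by
  have h1 := mul_resolventAt ht hA
  have h2 := resolventAt_mul ht (hA.add hB)
  calc _ = (resolventAt t (A + B) * (t • 1 + (A + B))) * resolventAt t A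
        - resolventAt t (A + B) * ((t • 1 + A) * resolventAt t A) := by rw [h1, h2]; simp
    _ = _ := by noncomm_ring

/-- Iterating the resolvent identity once gives R - G = GBG + (GB)R(GB)⋆, a sum of visibly positive
terms. -/
theorem posSemidef_resolventAt_sub {t : ℝ} (ht : 0 < t) (hA : A.PosSemidef)
    (hB : B.PosSemidef) : (resolventAt t A - resolventAt t (A + B)).PosSemidef := by
  set R := resolventAt t A with hR
  set G := resolventAt t (A + B) with hG
  have hRp : R.PosSemidef := posSemidef_resolventAt ht hA
  have hGp : G.PosSemidef := posSemidef_resolventAt ht (hA.add hB)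
  have h1 : R - G = R * B * G := resolventAt_sub ht hA hB
  have h2 : R - G = G * B * R := resolventAt_sub' ht hA hB
  have h3 : R - G = G * B * Gᴴ + (G * B) * R * (G * B)ᴴ := by
    rw [conjTranspose_mul, hGp.1.eq, hB.1.eq]
    calc R - G = G * B * (G + (R - G)) := by rw [h2]; congr 1; rw [← h2]; abel
      _ = G * B * (G + R * B * G) := by rw [h1]
      _ = _ := by noncomm_ring
  rw [h3]
  exact (hB.mul_mul_conjTranspose_same G).add (hRp.mul_mul_conjTranspose_same (G * B))

/-- A resolvent difference, tested against the perturbation `C⋆ C`, is a trace function of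
`C (t + A)⁻¹ C⋆`. -/
theorem trace_resolventAt_sub_mul {t : ℝ} (ht : 0 < t) (hA : A.PosSemidef) (C : Matrix m m ℂ) :
    ((resolventAt t A - resolventAt t (A + Cᴴ * C)) * (Cᴴ * C)).trace.re =
      (cfc (fun x : ℝ => x + (1 + x)⁻¹) (C * resolventAt t A * Cᴴ)).trace.re
        - (1 : Matrix m m ℂ).trace.re := by
  have hN := posSemidef_conjTranspose_mul_self C
  set R := resolventAt t A with hR
  set G := resolventAt t (A + Cᴴ * C) with hG
  have hRp : R.PosSemidef := posSemidef_resolventAt ht hA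
  have h1 : R - G = R * (Cᴴ * C) * G := resolventAt_sub ht hA hN
  have hD : (C * R * Cᴴ).PosSemidef := hRp.mul_mul_conjTranspose_same C
  -- Push-through identity: (1 + CRC⋆)⁻¹ = 1 - CGC⋆, which removes `G` from the trace.
  have h2 : resolventAt 1 (C * R * Cᴴ) = 1 - C * G * Cᴴ := by
    have h3 : ((1 : ℝ) • 1 + C * R * Cᴴ) * (1 - C * G * Cᴴ) = 1 := by
      rw [one_smul]
      calc _ = 1 + C * ((R - G) - R * (Cᴴ * C) * G) * Cᴴ := by noncomm_ring
        _ = 1 := by rw [h1]; simp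
    calc _ = resolventAt 1 (C * R * Cᴴ) * (((1 : ℝ) • 1 + C * R * Cᴴ) * (1 - C * G * Cᴴ)) := by
          rw [h3, mul_one]
      _ = _ := by rw [← mul_assoc, resolventAt_mul one_pos hD, one_mul]
  rw [cfc_add _ _ _ (continuousOn_spectrum _ _) (continuousOn_spectrum _ _),
    cfc_id' ℝ _ hD.1.isSelfAdjoint]
  change _ = (C * R * Cᴴ + resolventAt 1 (C * R * Cᴴ)).trace.re - _
  rw [h2, ← Complex.sub_re, ← trace_sub, ← mul_assoc, trace_mul_comm, ← mul_assoc]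
  congr 2
  noncomm_ring

/-- With B = C⋆C, both sides are values of Tr ψ, up to the same constant, at D = C(t+A)⁻¹C⋆ and E =
C t⁻¹ C⋆, where ψ(x) = x + 1/(1+x) is convex and increasing on x ≥ 0. Since D ≤ E, Klein's
inequality at D and ψ'(D) ≥ 0 conclude. -/
theorem trace_resolventAt_sub_mul_le {t : ℝ} (ht : 0 < t) (hA : A.PosSemidef)
    (hB : B.PosSemidef) :
    ((resolventAt t A - resolventAt t (A + B)) * B).trace.re ≤
      ((resolventAt t 0 - resolventAt t B) * B).trace.re := by
  obtain ⟨C, rfl⟩ := CStarAlgebra.nonneg_iff_eq_star_mul_self.mp hB.nonneg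
  rw [star_eq_conjTranspose] at *
  have h0 := trace_resolventAt_sub_mul ht (PosSemidef.zero (n := m) (R := ℂ)) C
  rw [zero_add] at h0
  rw [h0, trace_resolventAt_sub_mul ht hA C]
  have hD := (posSemidef_resolventAt ht hA).mul_mul_conjTranspose_same C
  have hE := (posSemidef_resolventAt ht (PosSemidef.zero (n := m) (R := ℂ))).mul_mul_conjTranspose_same C
  have hsub := (posSemidef_resolventAt_sub ht (PosSemidef.zero (n := m) (R := ℂ))
    hA).mul_mul_conjTranspose_same C
  rw [zero_add, mul_sub, sub_mul] at hsub
  have hψ := posSemidef_cfc (fun x : ℝ => 1 - ((1 + x)⁻¹) ^ 2) (fun x hx => by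
    have : (1 + x)⁻¹ ≤ 1 := inv_le_one_of_one_le₀ (by linarith)
    have h' : 0 ≤ (1 + x)⁻¹ := by positivity
    nlinarith) hD
  have hK := klein_inequality hD.1 hE.1 (fun x : ℝ => x + (1 + x)⁻¹)
    (fun x : ℝ => 1 - ((1 + x)⁻¹) ^ 2) (fun i j => by
      have hx := hD.eigenvalues_nonneg i
      have hy := hE.eigenvalues_nonneg j
      set x := hD.1.eigenvalues i
      set y := hE.1.eigenvalues j
      have : y + (1 + y)⁻¹ - (x + (1 + x)⁻¹ + (1 - ((1 + x)⁻¹) ^ 2) * (y - x)) =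
        (y - x) ^ 2 / ((1 + y) * (1 + x) ^ 2) := by field_simp; ring
      have h' : 0 ≤ (y - x) ^ 2 / ((1 + y) * (1 + x) ^ 2) := by positivity
      linarith)
  have := trace_mul_re_nonneg hψ hsub
  linarith

end MatrixTrace

/-! ### Fractional powers by resolvent integrals, and smoothness of Tr X^(ν+1) -/

section PowerTrace

variable {m : Type*} [Fintype m] [DecidableEq m] {A B : Matrix m m ℂ}

open Matrix MeasureTheory
open scoped MatrixOrder

theorem cfc_rpowIntegrand (ν t : ℝ) (hA : A.IsHermitian) :
    cfc (rpowIntegrand₀₁ ν t) A = (t ^ ν) • (t⁻¹ • (1 : Matrix m m ℂ) - resolventAt t A) := by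
  rw [resolventAt, ← Algebra.algebraMap_eq_smul_one, ← cfc_const t⁻¹ A hA.isSelfAdjoint,
    ← cfc_sub _ _ A (continuousOn_spectrum A _) (continuousOn_spectrum A _),
    ← cfc_smul _ _ A (continuousOn_spectrum A _)]
  rfl

/-- Diagonalizing `A` reduces this to finitely many scalar integrals, so no matrix-valued
integration is needed. One measure serves all matrices, so the integrals can be compared pointwise.
-/
theorem exists_measure_trace_rpow_mul {ν : ℝ} (hν : ν ∈ Set.Ioo (0 : ℝ) 1) :
    ∃ μ : Measure ℝ, ∀ A B : Matrix m m ℂ, A.PosSemidef →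
      IntegrableOn (fun t => (cfc (rpowIntegrand₀₁ ν t) A * B).trace.re) (Set.Ioi 0) μ ∧
      (cfc (fun x : ℝ => x ^ ν) A * B).trace.re =
        ∫ t in Set.Ioi 0, (cfc (rpowIntegrand₀₁ ν t) A * B).trace.re ∂μ := by
  obtain ⟨μ, hμ⟩ := exists_measure_rpow_eq_integral_rpowIntegrand₀₁ hν
  refine ⟨μ, fun A B hA => ?_⟩
  simp only [trace_cfc_mul_re hA.1]
  have hi : ∀ i, IntegrableOn (fun t => rpowIntegrand₀₁ ν t (hA.1.eigenvalues i) *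
      ((star (hA.1.eigenvectorUnitary : Matrix m m ℂ) * B * hA.1.eigenvectorUnitary) i i).re)
      (Set.Ioi 0) μ := fun i => (hμ _ (hA.eigenvalues_nonneg i)).1.mul_const _
  refine ⟨integrable_finsetSum _ fun i _ => hi i, ?_⟩
  rw [integral_finsetSum _ fun i _ => hi i]
  refine Finset.sum_congr rfl fun i _ => ?_
  rw [integral_mul_const, ← (hμ _ (hA.eigenvalues_nonneg i)).2]

/-- Operator monotonicity of x^ν in tested form, inherited from the resolvents under the integral.
-/
theorem trace_rpow_add_mul_ge {ν : ℝ} (h0 : 0 < ν) (h1 : ν ≤ 1) {P : Matrix m m ℂ}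
    (hA : A.PosSemidef) (hB : B.PosSemidef) (hP : P.PosSemidef) :
    (cfc (fun x : ℝ => x ^ ν) A * P).trace.re ≤ (cfc (fun x : ℝ => x ^ ν) (A + B) * P).trace.re := by
  -- The integral representation needs ν < 1; the case ν = 1 corresponds to α = 1/2.
  rcases h1.eq_or_lt with rfl | h1
  · simp only [rpow_one]
    rw [cfc_id' ℝ _ hA.1.isSelfAdjoint, cfc_id' ℝ _ (hA.add hB).1.isSelfAdjoint, add_mul, trace_add,
      Complex.add_re]
    linarith [trace_mul_re_nonneg hB hP]
  obtain ⟨μ, hμ⟩ := exists_measure_trace_rpow_mul (m := m) (ν := ν) ⟨h0, h1⟩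
  rw [(hμ A P hA).2, (hμ (A + B) P (hA.add hB)).2]
  refine setIntegral_mono_on (hμ A P hA).1 (hμ (A + B) P (hA.add hB)).1 measurableSet_Ioi
    fun t (ht : 0 < t) => ?_
  have h := trace_mul_re_nonneg (posSemidef_resolventAt_sub ht hA hB) hP
  have ht' : 0 ≤ t ^ ν := by positivity
  rw [cfc_rpowIntegrand ν t hA.1, cfc_rpowIntegrand ν t (hA.add hB).1]
  simp only [smul_mul_assoc, trace_smul, Complex.smul_re, sub_mul, trace_sub, Complex.sub_re] at h ⊢
  exact smul_le_smul_of_nonneg_left (by linarith) ht'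

/-- The increment of x^ν in direction `B`, tested against `B` itself, is largest from the base point
0. Under the integral this is `trace_resolventAt_sub_mul_le`. -/
theorem trace_rpow_add_sub_mul_le {ν : ℝ} (h0 : 0 < ν) (h1 : ν ≤ 1)
    (hA : A.PosSemidef) (hB : B.PosSemidef) :
    (cfc (fun x : ℝ => x ^ ν) (A + B) * B).trace.re - (cfc (fun x : ℝ => x ^ ν) A * B).trace.re ≤
      (cfc (fun x : ℝ => x ^ ν) B * B).trace.re := by
  rcases h1.eq_or_lt with rfl | h1
  · simp only [rpow_one]
    rw [cfc_id' ℝ _ hA.1.isSelfAdjoint, cfc_id' ℝ _ (hA.add hB).1.isSelfAdjoint,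
      cfc_id' ℝ _ hB.1.isSelfAdjoint, add_mul, trace_add, Complex.add_re]
    linarith
  obtain ⟨μ, hμ⟩ := exists_measure_trace_rpow_mul (m := m) (ν := ν) ⟨h0, h1⟩
  rw [(hμ A B hA).2, (hμ (A + B) B (hA.add hB)).2, (hμ B B hB).2,
    ← integral_sub (hμ (A + B) B (hA.add hB)).1 (hμ A B hA).1]
  refine setIntegral_mono_on ((hμ (A + B) B (hA.add hB)).1.sub (hμ A B hA).1) (hμ B B hB).1
    measurableSet_Ioi fun t (ht : 0 < t) => ?_
  have h := trace_resolventAt_sub_mul_le ht hA hB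
  have ht' : 0 ≤ t ^ ν := by positivity
  have hz : resolventAt t (0 : Matrix m m ℂ) = t⁻¹ • (1 : Matrix m m ℂ) := by
    rw [resolventAt, cfc_apply_zero, add_zero, Algebra.algebraMap_eq_smul_one]
  rw [hz] at h
  rw [cfc_rpowIntegrand ν t hA.1, cfc_rpowIntegrand ν t (hA.add hB).1, cfc_rpowIntegrand ν t hB.1]
  simp only [smul_mul_assoc, trace_smul, Complex.smul_re, sub_mul, trace_sub, Complex.sub_re,
    smul_eq_mul, ← mul_sub] at h ⊢
  exact mul_le_mul_of_nonneg_left (by linarith) ht'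

theorem cfc_rpow_mul_self {ν : ℝ} (h0 : 0 < ν) (hA : A.PosSemidef) :
    cfc (fun x : ℝ => x ^ ν) A * A = cfc (fun x : ℝ => x ^ (ν + 1)) A := by
  nth_rw 2 [← cfc_id' ℝ A hA.1.isSelfAdjoint]
  rw [← cfc_mul _ _ A (continuousOn_spectrum A _) (continuousOn_spectrum A _)]
  refine cfc_congr fun x hx => ?_
  have hx := spectrum_nonneg_of_nonneg hA.nonneg hx
  rw [rpow_add' hx (by positivity), rpow_one]

/-- Tangent line inequality for a real power. -/
theorem rpow_add_mul_sub_le {ν x y : ℝ} (h0 : 0 < ν) (hx : 0 ≤ x) (hy : 0 ≤ y) :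
    x ^ (ν + 1) + (ν + 1) * x ^ ν * (y - x) ≤ y ^ (ν + 1) := by
  rcases hx.eq_or_lt with rfl | hx
  · rw [zero_rpow (by positivity), zero_rpow h0.ne']
    simpa using rpow_nonneg hy _
  have h := one_add_mul_self_le_rpow_one_add (s := y / x - 1) (p := ν + 1)
    (by linarith [div_nonneg hy hx.le]) (by linarith)
  rw [add_sub_cancel, div_rpow hy hx.le, le_div_iff₀ (by positivity)] at h
  refine le_trans (le_of_eq ?_) h
  rw [rpow_add hx, rpow_one]
  field_simp

theorem trace_rpow_klein {ν : ℝ} (h0 : 0 < ν) (hA : A.PosSemidef) (hB : B.PosSemidef) :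
    (cfc (fun x : ℝ => x ^ (ν + 1)) A).trace.re +
      (ν + 1) * (cfc (fun x : ℝ => x ^ ν) A * (B - A)).trace.re ≤
      (cfc (fun x : ℝ => x ^ (ν + 1)) B).trace.re := by
  have h := klein_inequality hA.1 hB.1 (fun x : ℝ => x ^ (ν + 1)) (fun x : ℝ => (ν + 1) * x ^ ν)
    (fun i j => rpow_add_mul_sub_le h0 (hA.eigenvalues_nonneg i) (hB.eigenvalues_nonneg j))
  rw [cfc_const_mul _ _ _ (continuousOn_spectrum A _), smul_mul_assoc, trace_smul,
    Complex.smul_re] at h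
  exact h

/-- Uniform smoothness of the trace of a power: the Bregman divergence between `Z + N` and `Z + P`
is at most the traces of the powers of `N` and `P`. -/
theorem trace_rpow_smooth {ν : ℝ} (h0 : 0 < ν) (h1 : ν ≤ 1) {Z N P : Matrix m m ℂ}
    (hZ : Z.PosSemidef) (hN : N.PosSemidef) (hP : P.PosSemidef) :
    (cfc (fun x : ℝ => x ^ (ν + 1)) (Z + P)).trace.re ≤
      (cfc (fun x : ℝ => x ^ (ν + 1)) (Z + N)).trace.re +
      (ν + 1) * (cfc (fun x : ℝ => x ^ ν) (Z + N) * (P - N)).trace.re +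
      (ν + 1) * ((cfc (fun x : ℝ => x ^ (ν + 1)) N).trace.re +
        (cfc (fun x : ℝ => x ^ (ν + 1)) P).trace.re) := by
  -- Tangents at Z+P and at Z compare the traces at Z+P, Z and Z+N. `k3` and `k4` replace the powers
  -- of Z+P and Z by those of Z and Z+N, at the cost of Tr P^(ν+1) and Tr N^(ν+1). `k5` moves the
  -- base point of the P-term from Z to Z+N.
  have k1 := trace_rpow_klein h0 (hZ.add hP) hZ
  have k2 := trace_rpow_klein h0 hZ (hZ.add hN)
  have k3 := trace_rpow_add_sub_mul_le h0 h1 hZ hP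
  have k4 := trace_rpow_add_sub_mul_le h0 h1 hZ hN
  have k5 := trace_rpow_add_mul_ge h0 h1 hZ hN hP
  rw [cfc_rpow_mul_self h0 hP] at k3
  rw [cfc_rpow_mul_self h0 hN] at k4
  have e1 : Z - (Z + P) = -P := by abel
  have e2 : Z - (Z + N) = -N := by abel
  rw [e1, mul_neg, trace_neg, Complex.neg_re] at k1
  rw [add_sub_cancel_left] at k2
  rw [mul_sub, trace_sub, Complex.sub_re]
  have hr : 0 < ν + 1 := by linarith
  linarith [mul_le_mul_of_nonneg_left k3 hr.le, mul_le_mul_of_nonneg_left k4 hr.le,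
    mul_le_mul_of_nonneg_left k5 hr.le]

end PowerTrace

/-! ### Convexity, Hölder smoothness and gradient of the exponentiated objective -/

section Objective

open Matrix
open scoped MatrixOrder

variable {n d : ℕ} {W : Fin n → Matrix (Fin d) (Fin d) ℂ} {α : ℝ} {x y p : Fin n → ℝ}

theorem trace_cfc_rpow_smul {m : Type*} [Fintype m] [DecidableEq m] {A : Matrix m m ℂ}
    (hA : A.PosSemidef) {c : ℝ} (hc : 0 ≤ c) (r : ℝ) :
    (cfc (fun x : ℝ => x ^ r) (c • A)).trace.re = c ^ r * (cfc (fun x : ℝ => x ^ r) A).trace.re := by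
  rw [← cfc_comp_smul c (fun x : ℝ => x ^ r) A
      ((A.finite_real_spectrum.image _).continuousOn _) hA.1.isSelfAdjoint,
    ← smul_eq_mul, ← Complex.smul_re, ← trace_smul,
    ← cfc_smul _ _ A (continuousOn_spectrum A _)]
  congr 2
  refine cfc_congr fun x hx => ?_
  exact mul_rpow hc (spectrum_nonneg_of_nonneg hA.nonneg hx)

/-- The matrix `∑ j, x[j] W(j)^α`. -/
noncomputable def powerMix (α : ℝ) (W : Fin n → Matrix (Fin d) (Fin d) ℂ) (x : Fin n → ℝ) :
    Matrix (Fin d) (Fin d) ℂ :=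
  ∑ j, x j • matPow (W j) α

/-- The gradient `(1/α) Tr[(∑ k, x[k] W(k)^α)^(1/α-1) W(j)^α]` of the exponentiated objective. -/
noncomputable def expRenyiGrad (α : ℝ) (W : Fin n → Matrix (Fin d) (Fin d) ℂ) (x : Fin n → ℝ) :
    Fin n → ℝ :=
  fun j => 1 / α * (cfc (fun x : ℝ => x ^ (1 / α - 1)) (powerMix α W x) * matPow (W j) α).trace.re

theorem expRenyiGrad_dotProduct (v : Fin n → ℝ) :
    expRenyiGrad α W x ⬝ᵥ v =
      1 / α * (cfc (fun x : ℝ => x ^ (1 / α - 1)) (powerMix α W x) * powerMix α W v).trace.re := by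
  simp only [dotProduct, expRenyiGrad, powerMix, Finset.mul_sum, trace_sum, Complex.re_sum,
    Algebra.mul_smul_comm, trace_smul, Complex.smul_re, smul_eq_mul]
  exact Finset.sum_congr rfl fun j _ => by ring

theorem expRenyi_eq : expRenyi α W x =
    (cfc (fun x : ℝ => x ^ (1 / α)) (powerMix α W x)).trace.re := rfl

theorem powerMix_add : powerMix α W (x + y) = powerMix α W x + powerMix α W y := by
  simp [powerMix, add_smul, Finset.sum_add_distrib]

theorem powerMix_sub : powerMix α W (x - y) = powerMix α W x - powerMix α W y := by
  simp [powerMix, sub_smul, Finset.sum_sub_distrib]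

theorem powerMix_single (j : Fin n) (c : ℝ) :
    powerMix α W (Pi.single j c) = c • matPow (W j) α := by
  rw [powerMix, Finset.sum_eq_single j (fun k _ hk => by simp [hk]) (by simp), Pi.single_eq_same]

theorem posSemidef_matPow (hW : ∀ j, IsDensityMatrix (W j)) (j : Fin n) :
    (matPow (W j) α).PosSemidef :=
  posSemidef_cfc _ (fun _ hx => rpow_nonneg hx _) (hW j).1

theorem posSemidef_powerMix (hW : ∀ j, IsDensityMatrix (W j)) (hx : 0 ≤ x) :
    (powerMix α W x).PosSemidef :=
  posSemidef_sum _ fun j _ => (posSemidef_matPow hW j).smul (hx j)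

theorem expRenyiGrad_nonneg (hα : 0 < α) (hW : ∀ j, IsDensityMatrix (W j)) (hx : 0 ≤ x) :
    0 ≤ expRenyiGrad α W x := fun j => by
  refine mul_nonneg (by positivity) (trace_mul_re_nonneg ?_ (posSemidef_matPow hW j))
  exact posSemidef_cfc _ (fun _ hx => rpow_nonneg hx _) (posSemidef_powerMix hW hx)

theorem expRenyi_single (hα : 0 < α) (hW : ∀ j, IsDensityMatrix (W j)) (j : Fin n) {c : ℝ}
    (hc : 0 ≤ c) : expRenyi α W (Pi.single j c) = c ^ (1 / α) := by
  rw [expRenyi_eq, powerMix_single, trace_cfc_rpow_smul (posSemidef_matPow hW j) hc, matPow,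
    ← cfc_comp' (fun x : ℝ => x ^ (1 / α)) (fun x : ℝ => x ^ α) (W j)
      (((W j).finite_real_spectrum.image _).continuousOn _) (continuousOn_spectrum _ _)
      (hW j).1.1.isSelfAdjoint]
  have : cfc (fun x : ℝ => (x ^ α) ^ (1 / α)) (W j) = W j := by
    conv_rhs => rw [← cfc_id' ℝ (W j) (hW j).1.1.isSelfAdjoint]
    refine cfc_congr fun x hx => ?_
    have hx := spectrum_nonneg_of_nonneg (hW j).1.nonneg hx
    rw [← rpow_mul hx, mul_one_div_cancel hα.ne', rpow_one]
  rw [this, (hW j).2]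
  simp

theorem expRenyi_tangent_le (hα0 : 0 < α) (hα1 : α < 1) (hW : ∀ j, IsDensityMatrix (W j))
    (hx : 0 ≤ x) (hy : 0 ≤ y) :
    expRenyi α W x + expRenyiGrad α W x ⬝ᵥ (y - x) ≤ expRenyi α W y := by
  have hν : 0 < 1 / α - 1 := by rw [sub_pos, lt_div_iff₀ hα0]; linarith
  have h := trace_rpow_klein hν (posSemidef_powerMix (α := α) hW hx)
    (posSemidef_powerMix (α := α) hW hy)
  rw [expRenyiGrad_dotProduct, powerMix_sub, expRenyi_eq, expRenyi_eq]
  rwa [sub_add_cancel] at h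

/-- Jensen's inequality: x is the average of the vertices c·e_j with weights x_j/c, where c = ∑ x_j,
and the objective equals c^(1/α) at each vertex since the states have trace one. -/
theorem expRenyi_le_sum_rpow (hα0 : 0 < α) (hα1 : α < 1) (hW : ∀ j, IsDensityMatrix (W j))
    (hx : 0 ≤ x) : expRenyi α W x ≤ (∑ j, x j) ^ (1 / α) := by
  have hr : 1 / α ≠ 0 := by positivity
  set c := ∑ j, x j with hc
  have hc0 : 0 ≤ c := Finset.sum_nonneg fun j _ => hx j
  rcases hc0.eq_or_lt with h0 | hcpos
  · have hz : x = 0 := by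
      funext j
      exact (Finset.sum_eq_zero_iff_of_nonneg fun j _ => hx j).mp (hc ▸ h0.symm) j (Finset.mem_univ j)
    have h := trace_cfc_rpow_smul (PosSemidef.zero (n := Fin d) (R := ℂ)) le_rfl (1 / α)
    rw [zero_smul, zero_rpow hr, zero_mul] at h
    rw [← h0, expRenyi_eq, hz, zero_rpow hr]
    simp only [powerMix, Pi.zero_apply, zero_smul, Finset.sum_const_zero]
    exact h.le
  have h : ∀ j ∈ Finset.univ, x j * (expRenyi α W x +
      expRenyiGrad α W x ⬝ᵥ (Pi.single j c - x)) ≤ x j * c ^ (1 / α) := fun j _ => by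
    refine mul_le_mul_of_nonneg_left ?_ (hx j)
    rw [← expRenyi_single hα0 hW j hc0]
    exact expRenyi_tangent_le hα0 hα1 hW hx (Pi.single_nonneg.mpr hc0)
  have h2 := Finset.sum_le_sum h
  simp only [dotProduct_sub, dotProduct_single, mul_add, mul_sub, Finset.sum_add_distrib,
    Finset.sum_sub_distrib, ← Finset.sum_mul, ← hc, ← mul_assoc] at h2
  have h3 : expRenyiGrad α W x ⬝ᵥ x = ∑ j, x j * expRenyiGrad α W x j := by
    simp [dotProduct, mul_comm]
  rw [← h3] at h2
  refine le_of_mul_le_mul_left ?_ hcpos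
  linarith

theorem expRenyi_le_one (hα0 : 0 < α) (hα1 : α < 1) (hW : ∀ j, IsDensityMatrix (W j))
    (hp : p ∈ stdSimplex ℝ (Fin n)) : expRenyi α W p ≤ 1 := by
  simpa [hp.2] using expRenyi_le_sum_rpow hα0 hα1 hW (x := p) hp.1

/-- The tangent at p_j e_j, for a coordinate p_j > 0, has nonnegative slope towards p, so the value
at p is at least p_j^(1/α). -/
theorem expRenyi_pos (hα0 : 0 < α) (hα1 : α < 1) (hW : ∀ j, IsDensityMatrix (W j))
    (hp : p ∈ stdSimplex ℝ (Fin n)) : 0 < expRenyi α W p := by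
  obtain ⟨j, -, hj⟩ : ∃ j ∈ Finset.univ, 0 < p j :=
    Finset.exists_lt_of_sum_lt (f := fun _ => (0 : ℝ)) (by simp [hp.2])
  have hs : 0 ≤ (Pi.single j (p j) : Fin n → ℝ) := Pi.single_nonneg.mpr hj.le
  have h := expRenyi_tangent_le hα0 hα1 hW hs hp.1
  rw [expRenyi_single hα0 hW j hj.le] at h
  have h2 : 0 ≤ expRenyiGrad α W (Pi.single j (p j)) ⬝ᵥ (p - Pi.single j (p j)) := by
    refine dotProduct_nonneg_of_nonneg (expRenyiGrad_nonneg hα0 hW hs) fun k => ?_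
    rcases eq_or_ne k j with rfl | hk
    · simp
    · simpa [hk] using hp.1 k
  have := rpow_pos_of_pos hj (1 / α)
  linarith

theorem l1Norm_nonneg (x : Fin n → ℝ) : 0 ≤ l1Norm x := Finset.sum_nonneg fun _ _ => abs_nonneg _

theorem expRenyi_le_tangent_add (hα0 : 1 / 2 ≤ α) (hα1 : α < 1)
    (hW : ∀ j, IsDensityMatrix (W j)) (hx : 0 ≤ x) (hy : 0 ≤ y) :
    expRenyi α W y ≤ expRenyi α W x + expRenyiGrad α W x ⬝ᵥ (y - x)
      + 1 / α * l1Norm (y - x) ^ (1 / α) := by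
  have hα : 0 < α := by linarith
  have hr : 1 ≤ 1 / α := by rw [le_div_iff₀ hα]; linarith
  have hν : 0 < 1 / α - 1 := by rw [sub_pos, lt_div_iff₀ hα]; linarith
  have hν1 : 1 / α - 1 ≤ 1 := by rw [sub_le_iff_le_add, div_le_iff₀ hα]; linarith
  set z := x ⊓ y
  have hz : 0 ≤ z := le_inf hx hy
  have hN : 0 ≤ x - z := sub_nonneg.mpr inf_le_left
  -- Both increments from z = min(x,y) are nonnegative with ℓ₁ norms adding up to that of y - x;
  -- superadditivity of u^(1/α) then merges the two error terms.
  have hP : 0 ≤ y - z := sub_nonneg.mpr inf_le_right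
  have h := trace_rpow_smooth hν hν1 (posSemidef_powerMix (α := α) hW hz)
    (posSemidef_powerMix (α := α) hW hN) (posSemidef_powerMix (α := α) hW hP)
  rw [← powerMix_sub, ← powerMix_add, ← powerMix_add, add_sub_cancel, add_sub_cancel,
    sub_sub_sub_cancel_right] at h
  simp only [sub_add_cancel] at h
  rw [← expRenyi_eq, ← expRenyi_eq, ← expRenyi_eq, ← expRenyi_eq, ← expRenyiGrad_dotProduct] at h
  have h1 := expRenyi_le_sum_rpow hα hα1 hW hN
  have h2 := expRenyi_le_sum_rpow hα hα1 hW hP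
  have hs : l1Norm (y - x) = ∑ j, (x - z) j + ∑ j, (y - z) j := by
    rw [← Finset.sum_add_distrib]
    refine Finset.sum_congr rfl fun j _ => ?_
    simp only [Pi.sub_apply, z, Pi.inf_apply]
    rcases le_total (x j) (y j) with h | h
    · rw [inf_eq_left.mpr h, abs_of_nonneg (by linarith)]; ring
    · rw [inf_eq_right.mpr h, abs_of_nonpos (by linarith)]; ring
  have h3 := add_rpow_le_rpow_add (Finset.sum_nonneg fun j (_ : j ∈ Finset.univ) => hN j)
    (Finset.sum_nonneg fun j (_ : j ∈ Finset.univ) => hP j) hr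
  rw [← hs] at h3
  have := mul_le_mul_of_nonneg_left ((add_le_add h1 h2).trans h3) (by positivity : 0 ≤ 1 / α)
  linarith

theorem l1Norm_le (x : Fin n → ℝ) : l1Norm x ≤ n * ‖x‖ := by
  calc l1Norm x ≤ ∑ _j : Fin n, ‖x‖ := Finset.sum_le_sum fun j _ => norm_le_pi_norm x j
    _ = n * ‖x‖ := by simp

/-- The remainder lies between 0 and a multiple of ‖y-x‖^(1/α), and 1/α > 1. This works at boundary
points and for singular matrices, where differentiating the power directly would be delicate. -/
theorem hasFDerivWithinAt_expRenyi (hα0 : 1 / 2 ≤ α) (hα1 : α < 1)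
    (hW : ∀ j, IsDensityMatrix (W j)) (hx : 0 ≤ x) :
    HasFDerivWithinAt (expRenyi α W)
      (LinearMap.toContinuousLinearMap (dotProductBilin ℝ ℝ (expRenyiGrad α W x)))
      (Set.Ici 0) x := by
  have hα : 0 < α := by linarith
  have hr : 0 < 1 / α - 1 := by rw [sub_pos, lt_div_iff₀ hα]; linarith
  rw [hasFDerivWithinAt_iff_isLittleO]
  have hO : (fun y => expRenyi α W y - expRenyi α W x -
      LinearMap.toContinuousLinearMap (dotProductBilin ℝ ℝ (expRenyiGrad α W x)) (y - x))
      =O[nhdsWithin x (Set.Ici 0)] fun y => ‖y - x‖ ^ (1 / α - 1) * ‖y - x‖ := by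
    refine Asymptotics.IsBigO.of_bound (1 / α * (n : ℝ) ^ (1 / α)) ?_
    filter_upwards [self_mem_nhdsWithin] with y hy
    have h1 := expRenyi_tangent_le hα hα1 hW hx hy
    have h2 := expRenyi_le_tangent_add hα0 hα1 hW hx hy
    have h3 : l1Norm (y - x) ^ (1 / α) ≤ (n : ℝ) ^ (1 / α) * ‖y - x‖ ^ (1 / α) := by
      rw [← mul_rpow (by positivity) (norm_nonneg _)]
      exact rpow_le_rpow (l1Norm_nonneg _) (l1Norm_le _) (by positivity)
    have h4 := mul_le_mul_of_nonneg_left h3 (by positivity : 0 ≤ 1 / α)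
    have h5 : ‖y - x‖ ^ (1 / α - 1) * ‖y - x‖ = ‖y - x‖ ^ (1 / α) := by
      nth_rw 2 [← rpow_one ‖y - x‖]
      rw [← rpow_add' (norm_nonneg _) (by simp [hα.ne']), sub_add_cancel]
    have h6 : LinearMap.toContinuousLinearMap (dotProductBilin ℝ ℝ (expRenyiGrad α W x)) (y - x)
      = expRenyiGrad α W x ⬝ᵥ (y - x) := rfl
    rw [h5, h6, norm_of_nonneg (by linarith : 0 ≤ expRenyi α W y - expRenyi α W x - _),
      norm_of_nonneg (by positivity : 0 ≤ ‖y - x‖ ^ (1 / α))]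
    linarith
  refine hO.trans_isLittleO ?_
  have h1 : Filter.Tendsto (fun y => ‖y - x‖ ^ (1 / α - 1)) (nhdsWithin x (Set.Ici 0)) (nhds 0) := by
    have : Continuous fun y => ‖y - x‖ ^ (1 / α - 1) :=
      (continuous_id.sub continuous_const).norm.rpow_const fun _ => Or.inr hr.le
    have h := this.tendsto x
    simp only [sub_self, norm_zero, zero_rpow hr.ne'] at h
    exact h.mono_left nhdsWithin_le_nhds
  have h2 := ((Asymptotics.isLittleO_one_iff ℝ).mpr h1).mul_isBigO
    (Asymptotics.isBigO_refl (fun y => ‖y - x‖) (nhdsWithin x (Set.Ici 0)))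
  simp only [one_mul] at h2
  exact h2.of_norm_right

theorem orthantGrad_expRenyi (hα0 : 1 / 2 ≤ α) (hα1 : α < 1)
    (hW : ∀ j, IsDensityMatrix (W j)) (hx : 0 ≤ x) :
    orthantGrad (expRenyi α W) x = expRenyiGrad α W x := by
  have hu : UniqueDiffWithinAt ℝ (Set.Ici (0 : Fin n → ℝ)) x := by
    refine uniqueDiffOn_convex (convex_Ici 0) ⟨fun _ => 1, ?_⟩ x hx
    refine mem_interior.mpr ⟨Set.pi Set.univ fun _ => Set.Ioi 0, fun y hy j => ?_,
      isOpen_set_pi Set.finite_univ fun _ _ => isOpen_Ioi, fun _ _ => one_pos (α := ℝ)⟩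
    exact (hy j trivial).le
  funext j
  rw [orthantGrad, (hasFDerivWithinAt_expRenyi hα0 hα1 hW hx).fderivWithin hu]
  exact dotProduct_single_one (expRenyiGrad α W x) j

end Objective

/-! ### Pinsker's inequality, Gibbs distributions and the entropic mirror step -/

section Entropy

variable {n : ℕ} {p q : Fin n → ℝ}

/-- The rational function agrees with log to third order at 1: the difference has derivative of the
sign of (x-1)³, hence its minimum, 0, at x = 1. This precision yields the sharp constant 1/2 in
`pinsker`. -/
theorem mul_le_log_of_pos {x : ℝ} (hx : 0 < x) :
    (x - 1) * (5 * x + 1) / (2 * x * (x + 2)) ≤ log x := by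
  set D : ℝ → ℝ := fun x => log x - (x - 1) * (5 * x + 1) / (2 * x * (x + 2)) with hD
  have hd : ∀ x : ℝ, 0 < x → HasDerivAt D ((x - 1) ^ 3 / (x ^ 2 * (x + 2) ^ 2)) x := by
    intro x hx
    have h1 : HasDerivAt (fun x : ℝ => (x - 1) * (5 * x + 1)) (10 * x - 4) x := by
      have := ((hasDerivAt_id x).sub_const 1).mul (((hasDerivAt_id x).const_mul 5).add_const 1)
      refine this.congr_deriv ?_
      simp only [id_eq]; ring
    have h2 : HasDerivAt (fun x : ℝ => 2 * x * (x + 2)) (4 * x + 4) x := by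
      have := ((hasDerivAt_id x).const_mul 2).mul ((hasDerivAt_id x).add_const 2)
      refine this.congr_deriv ?_
      simp only [id_eq]; ring
    refine ((hasDerivAt_log hx.ne').sub (h1.div h2 (by positivity))).congr_deriv ?_
    field_simp
    ring
  have h1 : D 1 = 0 := by simp [hD]
  suffices h : 0 ≤ D x by simpa [hD] using h
  rw [← h1]
  rcases le_total 1 x with h | h
  · have hm : MonotoneOn D (Set.Ici 1) := by
      refine monotoneOn_of_hasDerivWithinAt_nonneg (convex_Ici 1)
        (fun y (hy : 1 ≤ y) => (hd y (by linarith)).continuousAt.continuousWithinAt)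
        (fun y hy => (hd y ?_).hasDerivWithinAt) fun y hy => ?_
      all_goals rw [interior_Ici] at hy
      · linarith [Set.mem_Ioi.mp hy]
      · have : 0 ≤ y - 1 := by linarith [Set.mem_Ioi.mp hy]
        positivity
    exact hm Set.self_mem_Ici h h
  · have hm : AntitoneOn D (Set.Ioc 0 1) := by
      refine antitoneOn_of_hasDerivWithinAt_nonpos (convex_Ioc 0 1)
        (fun y hy => (hd y hy.1).continuousAt.continuousWithinAt)
        (fun y hy => (hd y (interior_subset hy).1).hasDerivWithinAt) fun y hy => ?_
      have hy := (interior_subset hy).2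
      exact div_nonpos_of_nonpos_of_nonneg (Odd.pow_nonpos (by decide) (by linarith)) (by positivity)
    exact hm ⟨hx, h⟩ ⟨one_pos, le_rfl⟩ h

/-- The Kullback-Leibler divergence of two vectors. -/
noncomputable def klVec (p q : Fin n → ℝ) : ℝ := ∑ j, p j * (log (p j) - log (q j))

theorem sq_div_le_mul_log_sub {a b : ℝ} (ha : 0 ≤ a) (hb : 0 < b) :
    |a - b| ^ 2 / (a + 2 * b) * (3 / 2) ≤ a * (log a - log b) - a + b := by
  rw [sq_abs]
  rcases ha.eq_or_lt with rfl | ha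
  · have : (0 - b) ^ 2 / (0 + 2 * b) * (3 / 2) = 3 / 4 * b := by field_simp; ring
    rw [this]; linarith
  have h := mul_le_mul_of_nonneg_left (mul_le_log_of_pos (div_pos ha hb)) ha.le
  rw [log_div ha.ne' hb.ne'] at h
  have e : a * ((a / b - 1) * (5 * (a / b) + 1) / (2 * (a / b) * (a / b + 2))) - a + b =
      (a - b) ^ 2 / (a + 2 * b) * (3 / 2) := by field_simp; ring
  linarith

/-- **Pinsker's inequality** on the probability simplex. -/
theorem pinsker (hp : p ∈ stdSimplex ℝ (Fin n)) (hq : q ∈ stdSimplex ℝ (Fin n))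
    (hpos : ∀ j, 0 < q j) : l1Norm (p - q) ^ 2 / 2 ≤ klVec p q := by
  have h1 : ∑ j, |p j - q j| ^ 2 / (p j + 2 * q j) * (3 / 2) ≤ klVec p q := by
    refine (Finset.sum_le_sum fun j _ => sq_div_le_mul_log_sub (hp.1 j) (hpos j)).trans_eq ?_
    rw [Finset.sum_add_distrib, Finset.sum_sub_distrib, hp.2, hq.2, klVec]
    ring
  have h2 := Finset.sq_sum_div_le_sum_sq_div Finset.univ (fun j => |p j - q j|)
    (g := fun j => p j + 2 * q j) fun j _ => by have := hp.1 j; have := hpos j; positivity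
  -- The Cauchy–Schwarz denominators p_j + 2q_j sum to 3, and (3/2)/3 = 1/2.
  rw [Finset.sum_add_distrib, ← Finset.mul_sum, hp.2, hq.2] at h2
  rw [← Finset.sum_mul] at h1
  have : l1Norm (p - q) ^ 2 = (∑ j, |p j - q j|) ^ 2 := rfl
  rw [this]
  linarith

theorem klVec_nonneg (hp : p ∈ stdSimplex ℝ (Fin n)) (hq : q ∈ stdSimplex ℝ (Fin n))
    (hpos : ∀ j, 0 < q j) : 0 ≤ klVec p q :=
  le_trans (by positivity) (pinsker hp hq hpos)

theorem eq_of_klVec_nonpos (hp : p ∈ stdSimplex ℝ (Fin n)) (hq : q ∈ stdSimplex ℝ (Fin n))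
    (hpos : ∀ j, 0 < q j) (h : klVec p q ≤ 0) : p = q := by
  have h1 := pinsker hp hq hpos
  have h2 : l1Norm (p - q) = 0 := pow_eq_zero_iff two_ne_zero |>.mp
    (le_antisymm (by linarith) (sq_nonneg _))
  funext j
  have := (Finset.sum_eq_zero_iff_of_nonneg fun j _ => abs_nonneg _).mp h2 j (Finset.mem_univ j)
  exact sub_eq_zero.mp (abs_eq_zero.mp this)

/-- The Gibbs distribution `exp(-c) / ‖exp(-c)‖₁`. -/
noncomputable def gibbs (c : Fin n → ℝ) : Fin n → ℝ :=
  fun j => exp (-c j) / ∑ k, exp (-c k)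

theorem sum_exp_pos [NeZero n] (c : Fin n → ℝ) : 0 < ∑ k, exp (-c k) :=
  Finset.sum_pos (fun _ _ => exp_pos _) Finset.univ_nonempty

theorem gibbs_pos [NeZero n] (c : Fin n → ℝ) (j : Fin n) : 0 < gibbs c j :=
  div_pos (exp_pos _) (sum_exp_pos c)

theorem gibbs_mem [NeZero n] (c : Fin n → ℝ) : gibbs c ∈ stdSimplex ℝ (Fin n) :=
  ⟨fun j => (gibbs_pos c j).le, by
    simp only [gibbs]
    rw [← Finset.sum_div, div_self (sum_exp_pos c).ne']⟩

theorem klVec_gibbs [NeZero n] (hp : p ∈ stdSimplex ℝ (Fin n)) (c : Fin n → ℝ) :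
    klVec p (gibbs c) = negEntropy p + c ⬝ᵥ p + log (∑ k, exp (-c k)) := by
  have : ∀ j, p j * (log (p j) - log (gibbs c j)) =
      p j * log (p j) + c j * p j + p j * log (∑ k, exp (-c k)) := fun j => by
    rw [gibbs, log_div (exp_pos _).ne' (sum_exp_pos c).ne', log_exp]; ring
  simp only [klVec, this, Finset.sum_add_distrib, ← Finset.sum_mul, hp.2, one_mul]
  rfl

/-- Gibbs variational principle: the excess over the minimum is exactly a divergence. It identifies
the minimizer, and with `pinsker` it gives strong convexity in ℓ₁. -/
theorem negEntropy_add_gibbs [NeZero n] (hp : p ∈ stdSimplex ℝ (Fin n)) (c : Fin n → ℝ) :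
    negEntropy p + c ⬝ᵥ p = negEntropy (gibbs c) + c ⬝ᵥ gibbs c + klVec p (gibbs c) := by
  have h := klVec_gibbs (gibbs_mem c) c
  have h' : klVec (gibbs c) (gibbs c) = 0 := by simp [klVec]
  rw [klVec_gibbs hp c]
  linarith

/-- A mirror step from the minimizer of φ_t therefore lands on the minimizer of φ_{t+1}. -/
theorem entropicStep_gibbs [NeZero n] (c v : Fin n → ℝ) (η : ℝ) :
    entropicStep (gibbs c) v η = gibbs (c + η • v) := by
  have e : ∀ k, gibbs c k * exp (-(η * v k)) = exp (-(c + η • v) k) / ∑ k, exp (-c k) := fun k => by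
    rw [gibbs, div_mul_eq_mul_div, ← exp_add]; simp; ring_nf
  have hs : l1Norm (fun k => gibbs c k * exp (-(η * v k))) =
      (∑ k, exp (-(c + η • v) k)) / ∑ k, exp (-c k) := by
    rw [Finset.sum_div]
    refine Finset.sum_congr rfl fun k _ => ?_
    rw [abs_of_nonneg (mul_nonneg (gibbs_pos c k).le (exp_pos _).le), e]
  funext j
  rw [entropicStep, hs, e, gibbs, div_div_div_cancel_right₀ (sum_exp_pos c).ne']

theorem uniform_eq_gibbs [NeZero n] : (fun _ : Fin n => 1 / (n : ℝ)) = gibbs 0 := by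
  funext j; simp [gibbs]

theorem negEntropy_nonpos (hp : p ∈ stdSimplex ℝ (Fin n)) : negEntropy p ≤ 0 :=
  Finset.sum_nonpos fun j _ => mul_nonpos_of_nonneg_of_nonpos (hp.1 j)
    (log_nonpos (hp.1 j) (hp.2 ▸ Finset.single_le_sum (fun j _ => hp.1 j) (Finset.mem_univ j)))

theorem hasFDerivAt_negEntropy (hq : ∀ j, 0 < q j) :
    HasFDerivAt negEntropy (∑ j, (log (q j) + 1) •
      (ContinuousLinearMap.proj j : (Fin n → ℝ) →L[ℝ] ℝ)) q := by
  refine HasFDerivAt.fun_sum fun j _ => ?_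
  have h := hasDerivAt_mul_log (hq j).ne'
  have h2 : HasFDerivAt (fun f : Fin n → ℝ => f j)
      (ContinuousLinearMap.proj j : (Fin n → ℝ) →L[ℝ] ℝ) q := hasFDerivAt_apply j q
  exact HasDerivAt.comp_hasFDerivAt (f := fun f : Fin n → ℝ => f j) q h h2

theorem bregman_negEntropy_uniform [NeZero n] (hp : p ∈ stdSimplex ℝ (Fin n)) :
    bregman negEntropy p (fun _ => 1 / (n : ℝ)) = negEntropy p + log n := by
  have hn : (0 : ℝ) < n := by exact_mod_cast Nat.pos_of_ne_zero (NeZero.ne n)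
  have hu : (fun _ : Fin n => 1 / (n : ℝ)) ∈ stdSimplex ℝ (Fin n) := by
    rw [uniform_eq_gibbs]; exact gibbs_mem 0
  rw [bregman, (hasFDerivAt_negEntropy fun _ => by positivity).fderiv]
  simp only [_root_.sum_apply, _root_.smul_apply,
    ContinuousLinearMap.proj_apply, smul_eq_mul, ← Finset.mul_sum, Pi.sub_apply,
    Finset.sum_sub_distrib, hp.2, hu.2, negEntropy]
  simp [hn.ne']

end Entropy

/-! ### Step sizes and termination of the line search -/

section LineSearch

variable {n : ℕ} {f : (Fin n → ℝ) → ℝ} {ε : ℝ} {s s' : FGMState n}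

namespace FGMState

theorem trialCoeff_pos (hL : 0 < s.L) (i : ℕ) : 0 < s.trialCoeff i := by
  unfold trialCoeff; positivity

theorem trialCoeff_eq (hL : 0 < s.L) (hA : 0 ≤ s.A) (i : ℕ) :
    2 ^ i * s.L * s.trialCoeff i ^ 2 = s.A + s.trialCoeff i := by
  have hs := sq_sqrt (by positivity : 0 ≤ 1 + 2 ^ (i + 2) * s.L * s.A)
  unfold trialCoeff
  set w := sqrt (1 + 2 ^ (i + 2) * s.L * s.A)
  have hL' := hL.ne'
  field_simp
  linear_combination 2 ^ i * hs

/-- Used to compare the last rejected trial with the accepted one. -/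
theorem trialCoeff_le_two_mul (hL : 0 < s.L) (hA : 0 ≤ s.A) (i : ℕ) :
    s.trialCoeff i ≤ 2 * s.trialCoeff (i + 1) := by
  have h : 2 * s.trialCoeff (i + 1) =
      (1 + sqrt (1 + 2 ^ (i + 3) * s.L * s.A)) / (2 ^ (i + 1) * s.L) := by
    unfold trialCoeff
    rw [pow_succ 2 (i + 1)]
    field_simp
  rw [h]
  unfold trialCoeff
  gcongr <;> norm_num

theorem trialCoeff_le_zero (hL : 0 < s.L) (hA : 0 ≤ s.A) (i : ℕ) :
    s.trialCoeff i ≤ s.trialCoeff 0 := by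
  by_contra! h
  have h0 := trialCoeff_pos hL 0
  have e0 := trialCoeff_eq hL hA 0
  have e := trialCoeff_eq hL hA i
  have h2 : (1 : ℝ) ≤ 2 ^ i := one_le_pow₀ one_le_two
  rw [pow_zero, one_mul] at e0
  have h3 : s.L * s.trialCoeff i ^ 2 ≤ s.A + s.trialCoeff i := by
    rw [← e, mul_assoc]
    exact le_mul_of_one_le_left (by positivity) h2
  nlinarith [mul_pos hL h0, mul_pos (sub_pos.mpr h) h0, mul_nonneg hA (sub_pos.mpr h).le,
    mul_le_mul_of_nonneg_right h3 h0.le]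

theorem trialWeight_pos (hL : 0 < s.L) (hA : 0 ≤ s.A) (i : ℕ) : 0 < s.trialWeight i := by
  have := trialCoeff_pos hL i
  unfold trialWeight; positivity

theorem trialWeight_le_one (hL : 0 < s.L) (hA : 0 ≤ s.A) (i : ℕ) : s.trialWeight i ≤ 1 := by
  have := trialCoeff_pos hL i
  unfold trialWeight
  rw [div_le_one (by positivity)]; linarith

theorem trialWeight_sq (hL : 0 < s.L) (hA : 0 ≤ s.A) (i : ℕ) :
    s.trialWeight i ^ 2 * (2 ^ i * s.L * (s.A + s.trialCoeff i)) = 1 := by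
  have h := trialCoeff_pos hL i
  have h1 : 0 < s.A + s.trialCoeff i := by positivity
  have e := trialCoeff_eq hL hA i
  unfold trialWeight
  rw [div_pow]
  field_simp
  linarith

theorem trialWeight_mul (hL : 0 < s.L) (hA : 0 ≤ s.A) (i : ℕ) :
    (s.A + s.trialCoeff i) * s.trialWeight i = s.trialCoeff i := by
  have h := trialCoeff_pos hL i
  unfold trialWeight
  field_simp

variable {q : Fin n → ℝ}

theorem trialMid_mem (hL : 0 < s.L) (hA : 0 ≤ s.A) (hp : s.p ∈ stdSimplex ℝ (Fin n))
    (hq : q ∈ stdSimplex ℝ (Fin n)) (i : ℕ) : s.trialMid q i ∈ stdSimplex ℝ (Fin n) :=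
  convex_stdSimplex ℝ _ hq hp (trialWeight_pos hL hA i).le
    (sub_nonneg.mpr (trialWeight_le_one hL hA i)) (by ring)

theorem trialNext_gibbs_mem [NeZero n] (hL : 0 < s.L) (hA : 0 ≤ s.A)
    (hp : s.p ∈ stdSimplex ℝ (Fin n)) (c : Fin n → ℝ) (i : ℕ) :
    s.trialNext f (gibbs c) i ∈ stdSimplex ℝ (Fin n) := by
  rw [trialNext, entropicStep_gibbs]
  exact convex_stdSimplex ℝ _ (gibbs_mem _) hp (trialWeight_pos hL hA i).le
    (sub_nonneg.mpr (trialWeight_le_one hL hA i)) (by ring)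

end FGMState

/-- Convexity and Hölder smoothness over the probability simplex, with the gradient relative to the
nonnegative orthant. -/
structure HolderSmooth (f : (Fin n → ℝ) → ℝ) (r : ℝ) : Prop where
  tangent_le : ∀ x ∈ stdSimplex ℝ (Fin n), ∀ y ∈ stdSimplex ℝ (Fin n),
    f x + orthantGrad f x ⬝ᵥ (y - x) ≤ f y
  le_tangent_add : ∀ x ∈ stdSimplex ℝ (Fin n), ∀ y ∈ stdSimplex ℝ (Fin n),
    f y ≤ f x + orthantGrad f x ⬝ᵥ (y - x) + r * l1Norm (y - x) ^ r

/-- Interpolation between Hölder smoothness and inexact smoothness. -/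
theorem two_mul_rpow_le {r M δ u : ℝ} (hr0 : 0 < r) (hr : r ≤ 2) (hM : 0 < M) (hδ : 0 < δ)
    (hu : 0 ≤ u) (h : 4 ≤ M ^ (r / 2) * δ ^ (1 - r / 2)) :
    r * u ^ r ≤ M / 2 * u ^ 2 + δ / 2 := by
  -- Weighted AM-GM for Mu² and δ gives 4u^r ≤ Mu² + δ, and r ≤ 2 costs the remaining factor.
  have h1 := geom_mean_le_arith_mean2_weighted (w₁ := r / 2) (w₂ := 1 - r / 2) (by positivity)
    (by linarith) (by positivity : 0 ≤ M * u ^ 2) hδ.le (by ring)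
  rw [mul_rpow hM.le (by positivity), ← rpow_natCast u 2, ← rpow_mul hu] at h1
  have e : ((2 : ℕ) : ℝ) * (r / 2) = r := by push_cast; ring
  rw [e] at h1
  have h2 := mul_le_mul_of_nonneg_right h (rpow_nonneg hu r)
  have h3 : r * u ^ r ≤ 2 * u ^ r := mul_le_mul_of_nonneg_right hr (rpow_nonneg hu r)
  have h4 : r / 2 * (M * u ^ ((2 : ℕ) : ℝ)) ≤ M * u ^ ((2 : ℕ) : ℝ) :=
    mul_le_of_le_one_left (by positivity) (by linarith)
  have h5 : (1 - r / 2) * δ ≤ δ := mul_le_of_le_one_left hδ.le (by linarith)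
  rw [← rpow_natCast u 2]
  nlinarith

/-- A rejected trial step has a small smoothness estimate. -/
theorem rejected_bound [NeZero n] {β : ℝ} (hβ0 : 0 ≤ β) (hβ1 : β < 1)
    (hf : HolderSmooth f (2 / (1 + β))) (hε : 0 < ε) (hL : 0 < s.L) (hA : 0 ≤ s.A)
    (hp : s.p ∈ stdSimplex ℝ (Fin n)) {c : Fin n → ℝ} {i : ℕ}
    (hrej : ¬ s.Accept f ε (gibbs c) i) :
    (2 ^ i * s.L) ^ (2 - β) * ε ^ (2 * β) ≤ 256 * (s.A + s.trialCoeff i) ^ β := by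
  set M := 2 ^ i * s.L with hM
  set δ := ε * s.trialWeight i with hδ
  have hM0 : 0 < M := by positivity
  have hτ := FGMState.trialWeight_pos hL hA i
  have ha := FGMState.trialCoeff_pos hL i
  have hδ0 : 0 < δ := by positivity
  have hlt : M ^ (2 / (1 + β) / 2) * δ ^ (1 - 2 / (1 + β) / 2) < 4 := by
    by_contra! h
    refine hrej ?_
    have h1 := hf.le_tangent_add _ (FGMState.trialMid_mem hL hA hp (gibbs_mem c) i) _
      (FGMState.trialNext_gibbs_mem (f := f) hL hA hp c i)
    have h2 := two_mul_rpow_le (by positivity) (by rw [div_le_iff₀ (by linarith)]; linarith) hM0 hδ0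
      (l1Norm_nonneg (s.trialNext f (gibbs c) i - s.trialMid (gibbs c) i)) h
    unfold FGMState.Accept
    have e1 : 2 ^ i / 2 * s.L = M / 2 := by rw [hM]; ring
    have e2 : ε / 2 * s.trialWeight i = δ / 2 := by rw [hδ]; ring
    rw [e1, e2]
    linarith
  -- The power 2(1+β) clears the denominators in the exponents, and 4^(2(1+β)) ≤ 4⁴ = 256.
  -- Multiplying by (M(A+a))^β then eliminates τ, because τ²M(A+a) = 1.
  have h1 := rpow_le_rpow (by positivity) hlt.le (by positivity : 0 ≤ 2 * (1 + β))
  rw [mul_rpow (by positivity) (by positivity), ← rpow_mul hM0.le, ← rpow_mul hδ0.le] at h1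
  have e1 : 2 / (1 + β) / 2 * (2 * (1 + β)) = 2 := by field_simp
  have e2 : (1 - 2 / (1 + β) / 2) * (2 * (1 + β)) = 2 * β := by field_simp; ring
  have e3 : (4 : ℝ) ^ (2 * (1 + β)) ≤ 256 := by
    refine (rpow_le_rpow_of_exponent_le (by norm_num) (by linarith : 2 * (1 + β) ≤ 4)).trans ?_
    norm_num
  have e4 : δ ^ (2 * β) * (M * (s.A + s.trialCoeff i)) ^ β = ε ^ (2 * β) := by
    rw [rpow_mul hδ0.le, rpow_mul hε.le, ← mul_rpow (by positivity) (by positivity), rpow_two,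
      rpow_two, hδ, mul_pow, mul_assoc, FGMState.trialWeight_sq hL hA i, mul_one]
  rw [e1, e2] at h1
  have h2 := mul_le_mul_of_nonneg_right (h1.trans e3)
    (by positivity : 0 ≤ (M * (s.A + s.trialCoeff i)) ^ β)
  rw [mul_assoc, e4, mul_rpow hM0.le (by positivity)] at h2
  have e5 : M ^ (2 : ℝ) = M ^ (2 - β) * M ^ β := by rw [← rpow_add hM0]; ring_nf
  rw [e5] at h2
  refine le_of_mul_le_mul_right ?_ (by positivity : 0 < M ^ β)
  linarith

/-- The line search stops. -/
theorem exists_accept [NeZero n] {β : ℝ} (hβ0 : 0 ≤ β) (hβ1 : β < 1)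
    (hf : HolderSmooth f (2 / (1 + β))) (hε : 0 < ε) (hL : 0 < s.L) (hA : 0 ≤ s.A)
    (hp : s.p ∈ stdSimplex ℝ (Fin n)) (c : Fin n → ℝ) : ∃ i, s.Accept f ε (gibbs c) i := by
  by_contra! h
  have ha := FGMState.trialCoeff_pos hL 0
  set B := 256 * (s.A + s.trialCoeff 0) ^ β / ε ^ (2 * β) with hB
  -- Beyond 1 the exponent 2-β ≥ 1 can be dropped, while a_i ≤ a_0 keeps the right side of
  -- `rejected_bound` below a constant.
  obtain ⟨i, hi⟩ := pow_unbounded_of_one_lt (max B 1 / s.L) (one_lt_two (α := ℝ))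
  rw [div_lt_iff₀ hL] at hi
  have h1 := rejected_bound hβ0 hβ1 hf hε hL hA hp (h i)
  have hai := FGMState.trialCoeff_pos hL i
  have h2 : (s.A + s.trialCoeff i) ^ β ≤ (s.A + s.trialCoeff 0) ^ β :=
    rpow_le_rpow (by positivity) (by linarith [FGMState.trialCoeff_le_zero hL hA i]) hβ0
  have h3 : (2 ^ i * s.L) ^ (2 - β) ≤ B := by
    rw [hB, le_div_iff₀ (by positivity)]; linarith
  have h4 : 2 ^ i * s.L ≤ (2 ^ i * s.L) ^ (2 - β) :=
    self_le_rpow_of_one_le ((le_max_right _ _).trans hi.le) (by linarith)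
  linarith [le_max_left B 1]

end LineSearch

/-! ### The estimating-sequence invariant and the growth of A -/

section Convergence

variable {n : ℕ} {f : (Fin n → ℝ) → ℝ} {ε : ℝ} {s s' : FGMState n}

/-- The invariant of the method: the estimating function is the entropy plus an affine function,
and, shifted by a constant, it lies between `A (f(p_t) - ε/2)` and `log n + A f`. -/
structure FGMState.Invariant (f : (Fin n → ℝ) → ℝ) (ε : ℝ) (s : FGMState n) : Prop where
  p_mem : s.p ∈ stdSimplex ℝ (Fin n)
  A_nonneg : 0 ≤ s.A
  L_pos : 0 < s.L
  affine : ∃ (c : Fin n → ℝ) (k : ℝ), ∀ p ∈ stdSimplex ℝ (Fin n), s.φ p = negEntropy p + c ⬝ᵥ p + k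
  estimate : ∃ b : ℝ, ∀ p ∈ stdSimplex ℝ (Fin n),
    s.A * (f s.p - ε / 2) ≤ s.φ p + b ∧ s.φ p + b ≤ log n + s.A * f p

namespace FGMState

theorem invariant_init [NeZero n] : (init n).Invariant f ε where
  p_mem := by
    have : (init n).p = gibbs 0 := uniform_eq_gibbs
    rw [this]; exact gibbs_mem 0
  A_nonneg := le_rfl
  L_pos := one_pos
  affine := ⟨0, log n, fun p hp => by
    rw [zero_dotProduct, add_zero]; exact bregman_negEntropy_uniform hp⟩
  estimate := ⟨0, fun p hp => by
    have h : (init n).φ p = negEntropy p + log n := bregman_negEntropy_uniform hp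
    have hA : (init n).A = 0 := rfl
    have h1 := klVec_nonneg hp (gibbs_mem 0) (gibbs_pos 0)
    rw [klVec_gibbs hp] at h1
    simp only [zero_dotProduct, add_zero, Pi.zero_apply, neg_zero, exp_zero, Finset.sum_const,
      Finset.card_univ, Fintype.card_fin, nsmul_eq_mul, mul_one] at h1
    rw [hA, h, zero_mul, zero_mul]
    exact ⟨by linarith, by linarith [negEntropy_nonpos hp]⟩⟩

variable {c : Fin n → ℝ} {k : ℝ} {q : Fin n → ℝ}

theorem isMinOn_gibbs [NeZero n]
    (hφ : ∀ p ∈ stdSimplex ℝ (Fin n), s.φ p = negEntropy p + c ⬝ᵥ p + k) :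
    IsMinOn s.φ (stdSimplex ℝ (Fin n)) (gibbs c) := fun p hp => by
  have := klVec_nonneg hp (gibbs_mem c) (gibbs_pos c)
  rw [Set.mem_ofPred_eq, hφ p hp, hφ _ (gibbs_mem c), negEntropy_add_gibbs hp c]
  linarith

/-- The minimizer is unique, so any choice of q in a step is the Gibbs distribution and every run is
covered. -/
theorem eq_gibbs_of_isMinOn [NeZero n]
    (hφ : ∀ p ∈ stdSimplex ℝ (Fin n), s.φ p = negEntropy p + c ⬝ᵥ p + k)
    (hq : q ∈ stdSimplex ℝ (Fin n)) (hmin : IsMinOn s.φ (stdSimplex ℝ (Fin n)) q) :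
    q = gibbs c := by
  refine eq_of_klVec_nonpos hq (gibbs_mem c) (gibbs_pos c) ?_
  have h : s.φ q ≤ s.φ (gibbs c) := hmin (gibbs_mem c)
  rw [hφ q hq, hφ _ (gibbs_mem c), negEntropy_add_gibbs hq c] at h
  linarith

theorem l1Norm_smul (a : ℝ) (x : Fin n → ℝ) : l1Norm (a • x) = |a| * l1Norm x := by
  simp [l1Norm, abs_mul, Finset.mul_sum]

/-- Upper bound: the added linearization of `f` lies below `f`. Lower bound: the new function is
minimal at p̂, where it exceeds the old minimum by at least ‖p̂ - q‖₁²/2 plus the linearization.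
Combined with the tangent at x evaluated at p_t, the linear terms assemble to A'⟨g, y-x⟩ with A' = A
+ a, and the acceptance test closes the estimate; its slack A'τε/2 = aε/2 accumulates to A'ε/2. -/
theorem Invariant.update [NeZero n] {r : ℝ} (hf : HolderSmooth f r) (h : s.Invariant f ε)
    (hφ : ∀ p ∈ stdSimplex ℝ (Fin n), s.φ p = negEntropy p + c ⬝ᵥ p + k) {i : ℕ}
    (hacc : s.Accept f ε (gibbs c) i) : (s.update f (gibbs c) i).Invariant f ε := by
  obtain ⟨hp, hA, hL, -, b, hb⟩ := h
  have hai := trialCoeff_pos hL i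
  have hτ := trialWeight_pos hL hA i
  have hx := trialMid_mem hL hA hp (gibbs_mem c) i
  have hy := trialNext_gibbs_mem (f := f) hL hA hp c i
  have eτ := trialWeight_mul hL hA i
  have eτ2 := trialWeight_sq hL hA i
  set a := s.trialCoeff i with ha
  set τ := s.trialWeight i with hτdef
  set x := s.trialMid (gibbs c) i with hxdef
  set y := s.trialNext f (gibbs c) i with hydef
  set g := orthantGrad f x with hg
  have hyeq : y = τ • gibbs (c + a • g) + (1 - τ) • s.p := by
    rw [hydef, trialNext, entropicStep_gibbs]
  have hxeq : x = τ • gibbs c + (1 - τ) • s.p := rfl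
  have hyx : y - x = τ • (gibbs (c + a • g) - gibbs c) := by
    rw [hyeq, hxeq, smul_sub]; abel
  refine ⟨hy, by change 0 ≤ s.A + a; positivity, by change 0 < 2 ^ i / 2 * s.L; positivity,
    ⟨c + a • g, k, fun p hp => ?_⟩, b + a * (f x - g ⬝ᵥ x), fun p hpm => ⟨?_, ?_⟩⟩
  · change s.φ p + a * (g ⬝ᵥ p) = _
    rw [hφ p hp, add_dotProduct, smul_dotProduct, smul_eq_mul]; ring
  · change (s.A + a) * (f y - ε / 2) ≤ s.φ p + a * (g ⬝ᵥ p) + (b + a * (f x - g ⬝ᵥ x))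
    have h1 := (hb _ (gibbs_mem c)).1
    rw [hφ _ (gibbs_mem c)] at h1
    have h2 := hf.tangent_le x hx s.p hp
    have h3 := negEntropy_add_gibbs hpm (c + a • g)
    have h3' := klVec_nonneg hpm (gibbs_mem (c + a • g)) (gibbs_pos _)
    have h4 := negEntropy_add_gibbs (gibbs_mem (c + a • g)) c
    have h4' := pinsker (gibbs_mem (c + a • g)) (gibbs_mem c) (gibbs_pos c)
    have h5 : f y ≤ f x + g ⬝ᵥ (y - x) + 2 ^ i / 2 * s.L * l1Norm (y - x) ^ 2 + ε / 2 * τ := hacc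
    rw [hyx, dotProduct_smul, l1Norm_smul, abs_of_pos hτ, smul_eq_mul] at h5
    rw [hφ p hpm]
    simp only [add_dotProduct, smul_dotProduct, smul_eq_mul, dotProduct_sub] at h2 h3 h4 h5 ⊢
    set u := l1Norm (gibbs (c + a • g) - gibbs c)
    have h5' := mul_le_mul_of_nonneg_left h5 (by positivity : 0 ≤ s.A + a)
    -- The equation defining a makes the quadratic term of the test equal to the Pinsker term.
    have e1 : (s.A + a) * (2 ^ i / 2 * s.L * (τ * u) ^ 2) = u ^ 2 / 2 := by
      linear_combination u ^ 2 / 2 * eτ2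
    have e2 : (s.A + a) * (g ⬝ᵥ x) = a * (g ⬝ᵥ gibbs c) + s.A * (g ⬝ᵥ s.p) := by
      rw [hxeq, dotProduct_add, dotProduct_smul, dotProduct_smul, smul_eq_mul, smul_eq_mul]
      linear_combination (g ⬝ᵥ gibbs c - g ⬝ᵥ s.p) * eτ
    have h2' := mul_le_mul_of_nonneg_left h2 hA
    have e3 : (s.A + a) * (f x + τ * (g ⬝ᵥ gibbs (c + a • g) - g ⬝ᵥ gibbs c) +
        2 ^ i / 2 * s.L * (τ * u) ^ 2 + ε / 2 * τ) =
        (s.A + a) * f x + a * (g ⬝ᵥ gibbs (c + a • g) - g ⬝ᵥ gibbs c) + u ^ 2 / 2 + ε / 2 * a := by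
      linear_combination e1 + (g ⬝ᵥ gibbs (c + a • g) - g ⬝ᵥ gibbs c + ε / 2) * eτ
    rw [e3] at h5'
    linarith
  · change s.φ p + a * (g ⬝ᵥ p) + (b + a * (f x - g ⬝ᵥ x)) ≤ log n + (s.A + a) * f p
    have h1 := (hb p hpm).2
    have h2 := mul_le_mul_of_nonneg_left (hf.tangent_le x hx p hpm) hai.le
    rw [dotProduct_sub] at h2
    linarith

/-- An accepted step keeps the smoothness estimate bounded in terms of `A`. -/
theorem Accept.growth [NeZero n] {β : ℝ} (hβ0 : 0 ≤ β) (hβ1 : β < 1)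
    (hf : HolderSmooth f (2 / (1 + β))) (hε : 0 < ε) (hε1 : ε ≤ 1) (hL : 0 < s.L) (hA : 0 ≤ s.A)
    (hp : s.p ∈ stdSimplex ℝ (Fin n))
    (hs : s = init n ∨ s.L ^ (2 - β) * ε ^ (2 * β) ≤ 1024 * s.A ^ β) {i : ℕ}
    (hrej : ∀ k < i, ¬ s.Accept f ε (gibbs c) k) :
    (s.update f (gibbs c) i).L ^ (2 - β) * ε ^ (2 * β) ≤
      1024 * (s.update f (gibbs c) i).A ^ β := by
  change (2 ^ i / 2 * s.L) ^ (2 - β) * ε ^ (2 * β) ≤ 1024 * (s.A + s.trialCoeff i) ^ β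
  have ha := trialCoeff_pos hL i
  rcases i with _ | i
  · rcases hs with rfl | hs
    · have e : (init n).A + (init n).trialCoeff 0 = 1 := by
        simp [init, trialCoeff]
      rw [e, one_rpow]
      have h1 : (2 ^ 0 / 2 * (init n).L) ^ (2 - β) ≤ 1 :=
        rpow_le_one (by positivity) (by simp [init]; norm_num) (by linarith)
      have h2 : ε ^ (2 * β) ≤ 1 := rpow_le_one hε.le hε1 (by linarith)
      have := mul_le_one₀ h1 (by positivity) h2
      linarith
    · refine le_trans ?_ (hs.trans ?_)
      · gcongr
        · linarith
        · norm_num; linarith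
      · gcongr
        linarith
  · have h1 := rejected_bound hβ0 hβ1 hf hε hL hA hp (hrej i (Nat.lt_succ_self i))
    have e : (2 : ℝ) ^ (i + 1) / 2 * s.L = 2 ^ i * s.L := by ring
    rw [e]
    have hai := trialCoeff_pos hL i
    have h2 : (s.A + s.trialCoeff i) ^ β ≤ (2 * (s.A + s.trialCoeff (i + 1))) ^ β :=
      rpow_le_rpow (by positivity) (by linarith [trialCoeff_le_two_mul hL hA i]) hβ0
    rw [mul_rpow (by norm_num) (by positivity)] at h2
    have h3 : (2 : ℝ) ^ β ≤ 2 :=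
      (rpow_le_rpow_of_exponent_le (by norm_num) hβ1.le).trans_eq (rpow_one 2)
    have h4 := mul_le_mul_of_nonneg_right h3 (by positivity : 0 ≤ (s.A + s.trialCoeff (i + 1)) ^ β)
    have : 0 ≤ (s.A + s.trialCoeff (i + 1)) ^ β := by positivity
    linarith

/-- The growth of `A` in one step. -/
theorem rpow_growth {β A A' L : ℝ} (hβ0 : 0 ≤ β) (hβ1 : β < 1) (hε : 0 < ε) (hA : 0 ≤ A)
    (hA' : A < A') (hL : 0 < L) (hLA : 2 * L * (A' - A) ^ 2 = A')
    (hJ : L ^ (2 - β) * ε ^ (2 * β) ≤ 1024 * A' ^ β) :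
    A ^ (1 / (2 - β)) + ε ^ (β / (2 - β)) / 92 ≤ A' ^ (1 / (2 - β)) := by
  have hA0 : 0 < A' := hA.trans_lt hA'
  have hb : 0 < 2 - β := by linarith
  set σ := 1 / (2 - β) with hσ
  have hσ0 : 1 / 2 ≤ σ := by rw [hσ, div_le_div_iff₀ (by norm_num) hb]; linarith
  have hσ1 : σ ≤ 1 := by rw [hσ, div_le_one hb]; linarith
  have h1 : L * ε ^ (2 * (β / (2 - β))) ≤ 1024 * A' ^ (β * σ) := by
    have h := rpow_le_rpow (by positivity) hJ (by positivity : 0 ≤ σ)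
    rw [mul_rpow (by positivity) (by positivity), mul_rpow (by positivity) (by positivity),
      ← rpow_mul hL.le, ← rpow_mul hε.le, ← rpow_mul hA0.le] at h
    have e1 : (2 - β) * σ = 1 := by rw [hσ]; field_simp
    have e2 : 2 * β * σ = 2 * (β / (2 - β)) := by rw [hσ]; ring
    rw [e1, rpow_one, e2] at h
    refine h.trans (mul_le_mul_of_nonneg_right ?_ (by positivity))
    exact (rpow_le_rpow_of_exponent_le (by norm_num) hσ1).trans_eq (rpow_one _)
  have eβ : β * σ = 2 * σ - 1 := by rw [hσ]; field_simp; ring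
  set a := A' - A with ha
  have ha0 : 0 < a := sub_pos.mpr hA'
  -- Squared, this is 2La² = A' together with `h1`; the constant works since 2·1024 ≤ 46². The
  -- factor σ ≥ 1/2 later turns 46 into 92.
  have h2 : ε ^ (β / (2 - β)) / 46 ≤ A' ^ (σ - 1) * a := by
    refine le_of_sq_le_sq ?_ (by positivity)
    have e3 : (A' ^ (σ - 1)) ^ 2 * A' = A' ^ (β * σ) := by
      rw [← rpow_natCast, ← rpow_mul hA0.le]
      nth_rw 2 [← rpow_one A']
      rw [← rpow_add hA0, eβ]
      congr 1; push_cast; ring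
    have e4 : (ε ^ (β / (2 - β))) ^ 2 = ε ^ (2 * (β / (2 - β))) := by
      rw [← rpow_natCast, ← rpow_mul hε.le, mul_comm]; norm_num
    rw [div_pow, e4, mul_pow]
    have e5 : 2 * L * ((A' ^ (σ - 1)) ^ 2 * a ^ 2) = A' ^ (β * σ) := by
      rw [← e3]; linear_combination (A' ^ (σ - 1)) ^ 2 * hLA
    refine le_of_mul_le_mul_left (a := 2 * L) ?_ (by positivity)
    rw [e5]
    have : 0 < A' ^ (β * σ) := by positivity
    linarith
  -- Concavity of u^σ: its graph lies below the tangent at A'.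
  have h3 : A ^ σ ≤ A' ^ σ - σ * (A' ^ (σ - 1) * a) := by
    have h := rpow_one_add_le_one_add_mul_self (s := -(a / A')) (p := σ)
      (by rw [neg_le_neg_iff, div_le_one hA0]; linarith) (by linarith) hσ1
    have e6 : 1 + -(a / A') = A / A' := by rw [ha]; field_simp; ring
    rw [e6, div_rpow hA hA0.le, div_le_iff₀ (by positivity)] at h
    refine h.trans_eq ?_
    rw [rpow_sub_one hA0.ne']
    ring
  have h4 := mul_le_mul hσ0 h2 (by positivity) (by positivity)
  linarith

end FGMState

end Convergence

/-! ### Existence of runs and the convergence rate -/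

section Run

variable {n : ℕ} {f : (Fin n → ℝ) → ℝ} {ε : ℝ}

namespace FGMState

theorem Step.invariant [NeZero n] {r : ℝ} (hf : HolderSmooth f r) {s s' : FGMState n}
    (h : s.Invariant f ε) (hstep : Step f ε s s') : s'.Invariant f ε := by
  obtain ⟨q, hq, hmin, i, hacc, -, rfl⟩ := hstep
  obtain ⟨c, k, hφ⟩ := h.affine
  obtain rfl := eq_gibbs_of_isMinOn hφ hq hmin
  exact h.update hf hφ hacc

theorem Invariant.exists_step [NeZero n] {r : ℝ} (hf : HolderSmooth f r)
    (hsearch : ∀ (s : FGMState n), s.Invariant f ε → ∀ c, ∃ i, s.Accept f ε (gibbs c) i)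
    {s : FGMState n} (h : s.Invariant f ε) : ∃ s', s'.Invariant f ε ∧ Step f ε s s' := by
  classical
  obtain ⟨c, k, hφ⟩ := h.affine
  have hex := hsearch s h c
  have hstep : Step f ε s (s.update f (gibbs c) (Nat.find hex)) :=
    ⟨gibbs c, gibbs_mem c, isMinOn_gibbs hφ, _, Nat.find_spec hex, fun k hk => Nat.find_min hex hk,
      rfl⟩
  exact ⟨_, hstep.invariant hf h, hstep⟩

end FGMState

open FGMState

theorem exists_isFGMRun [NeZero n] {r : ℝ} (hf : HolderSmooth f r)
    (hsearch : ∀ (s : FGMState n), s.Invariant f ε → ∀ c, ∃ i, s.Accept f ε (gibbs c) i) (T : ℕ) :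
    ∃ s : ℕ → FGMState n, IsFGMRun f ε T s := by
  choose! next hnext using fun (s : FGMState n) (h : s.Invariant f ε) => h.exists_step hf hsearch
  let s : ℕ → FGMState n := fun t => next^[t - 1] (init n)
  have hs : ∀ t, 1 ≤ t → s (t + 1) = next (s t) := fun t ht => by
    obtain ⟨t, rfl⟩ := Nat.exists_eq_add_of_le' ht
    simp only [s, Nat.add_sub_cancel]
    exact Function.iterate_succ_apply' next t _
  have hinv : ∀ t, 1 ≤ t → (s t).Invariant f ε := fun t ht => by
    induction t, ht using Nat.le_induction with
    | base => exact invariant_init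
    | succ t ht ih => rw [hs t ht]; exact (hnext _ ih).1
  exact ⟨s, rfl, fun t ht _ => by rw [hs t ht]; exact (hnext _ (hinv t ht)).2⟩

theorem IsFGMRun.invariant [NeZero n] {r : ℝ} (hf : HolderSmooth f r) {T : ℕ}
    {s : ℕ → FGMState n} (hrun : IsFGMRun f ε T s) {t : ℕ} (ht : 1 ≤ t) (htT : t ≤ T + 1) :
    (s t).Invariant f ε := by
  induction t, ht using Nat.le_induction with
  | base => rw [hrun.1]; exact invariant_init
  | succ t ht ih => exact (hrun.2 t ht (by omega)).invariant hf (ih (by omega))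

/-- After `t` iterations `A^(1/(2-β)) ≥ t ε^(β/(2-β)) / 92`. -/
theorem IsFGMRun.growth [NeZero n] {β : ℝ} (hβ0 : 0 ≤ β) (hβ1 : β < 1)
    (hf : HolderSmooth f (2 / (1 + β))) (hε : 0 < ε) (hε1 : ε ≤ 1) {T : ℕ}
    {s : ℕ → FGMState n} (hrun : IsFGMRun f ε T s) {t : ℕ} (htT : t ≤ T) :
    t * (ε ^ (β / (2 - β)) / 92) ≤ (s (t + 1)).A ^ (1 / (2 - β)) ∧
    (s (t + 1) = init n ∨
      (s (t + 1)).L ^ (2 - β) * ε ^ (2 * β) ≤ 1024 * (s (t + 1)).A ^ β) := by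
  induction t with
  | zero =>
    refine ⟨?_, Or.inl hrun.1⟩
    rw [zero_add, hrun.1, Nat.cast_zero, zero_mul]
    exact rpow_nonneg le_rfl _
  | succ t ih =>
    obtain ⟨ih1, ih2⟩ := ih (by omega)
    have hinv := hrun.invariant hf (t := t + 1) (by omega) (by omega)
    obtain ⟨q, hq, hmin, i, -, hrej, hs⟩ := hrun.2 (t + 1) (by omega) (by omega)
    obtain ⟨c, k, hφ⟩ := hinv.affine
    obtain rfl := eq_gibbs_of_isMinOn hφ hq hmin
    have hJ := Accept.growth hβ0 hβ1 hf hε hε1 hinv.L_pos hinv.A_nonneg hinv.p_mem ih2 hrej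
    have ha := trialCoeff_pos hinv.L_pos i
    have hL := hinv.L_pos
    have hg := rpow_growth (A' := ((s (t + 1)).update f (gibbs c) i).A) hβ0 hβ1 hε hinv.A_nonneg
      (by change _ < (s (t + 1)).A + _; linarith)
      (L := ((s (t + 1)).update f (gibbs c) i).L)
      (by change 0 < 2 ^ i / 2 * (s (t + 1)).L; positivity)
      (by
        have e := trialCoeff_eq hL hinv.A_nonneg i
        change 2 * (2 ^ i / 2 * (s (t + 1)).L) *
          ((s (t + 1)).A + (s (t + 1)).trialCoeff i - (s (t + 1)).A) ^ 2 = _ + _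
        linear_combination e) hJ
    rw [hs]
    refine ⟨?_, Or.inr hJ⟩
    push_cast
    linarith

/-- The rate of the universal fast gradient method. -/
theorem IsFGMRun.error_le [NeZero n] {β : ℝ} (hβ0 : 0 ≤ β) (hβ1 : β < 1)
    (hf : HolderSmooth f (2 / (1 + β))) (hε : 0 < ε) (hε1 : ε ≤ 1) {T : ℕ} (hT : 1 ≤ T)
    (hεT : log n ≤ ε ^ (1 + β) * (T : ℝ) ^ (2 - β))
    {s : ℕ → FGMState n} (hrun : IsFGMRun f ε T s) {p : Fin n → ℝ}
    (hp : p ∈ stdSimplex ℝ (Fin n)) : f (s (T + 1)).p - f p ≤ 9000 * ε := by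
  have hinv := hrun.invariant hf (t := T + 1) (by omega) le_rfl
  have hg := (hrun.growth hβ0 hβ1 hf hε hε1 le_rfl).1
  obtain ⟨b, hb⟩ := hinv.estimate
  have h1 := (hb p hp).1.trans (hb p hp).2
  set A := (s (T + 1)).A
  have hA0 : 0 ≤ A := hinv.A_nonneg
  have hT0 : (0 : ℝ) < T := by exact_mod_cast hT
  have hb : 0 < 2 - β := by linarith
  have h2 := rpow_le_rpow (by positivity) hg hb.le
  rw [← rpow_mul hA0, one_div_mul_cancel hb.ne', rpow_one, mul_rpow (by positivity) (by positivity),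
    div_rpow (by positivity) (by positivity), ← rpow_mul hε.le, div_mul_cancel₀ _ hb.ne'] at h2
  -- Here 8464 = 92²; the final 9000 also absorbs the ε/2 of the invariant.
  have h3 : (92 : ℝ) ^ (2 - β) ≤ 8464 := by
    refine (rpow_le_rpow_of_exponent_le (by norm_num) (by linarith : 2 - β ≤ 2)).trans ?_
    norm_num
  have hApos : 0 < A := lt_of_lt_of_le (by positivity) h2
  have h4 : (T : ℝ) ^ (2 - β) * ε ^ β ≤ 8464 * A := by
    rw [← mul_div_assoc, div_le_iff₀ (by positivity)] at h2
    exact h2.trans (by rw [mul_comm]; exact mul_le_mul_of_nonneg_right h3 hA0)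
  have h5 : log n ≤ A * (8464 * ε) := by
    refine hεT.trans ?_
    rw [rpow_add hε, rpow_one]
    have := mul_le_mul_of_nonneg_left h4 hε.le
    linarith
  have h6 : A * (f (s (T + 1)).p - ε / 2) ≤ A * (8464 * ε + f p) := by linarith
  have := le_of_mul_le_mul_left h6 hApos
  linarith

end Run

/-! ### Specialization to the channel objective and transfer to the Rényi information -/

section MainTheorem

variable {n d : ℕ} {W : Fin n → Matrix (Fin d) (Fin d) ℂ} {α : ℝ}

theorem holderSmooth_expRenyi (hα0 : 1 / 2 ≤ α) (hα1 : α < 1) (hW : ∀ j, IsDensityMatrix (W j)) :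
    HolderSmooth (expRenyi α W) (2 / (1 + (2 * α - 1))) := by
  have e : 2 / (1 + (2 * α - 1)) = 1 / α := by
    have : α ≠ 0 := by linarith
    field_simp; ring
  have hα : 0 < α := by linarith
  have hr : 1 / α ≤ 2 := by rw [div_le_iff₀ hα]; linarith
  rw [e]
  refine ⟨fun x hx y hy => ?_, fun x hx y hy => ?_⟩
  · rw [orthantGrad_expRenyi hα0 hα1 hW hx.1]
    exact expRenyi_tangent_le hα hα1 hW hx.1 hy.1
  · rw [orthantGrad_expRenyi hα0 hα1 hW hx.1]
    exact expRenyi_le_tangent_add hα0 hα1 hW hx.1 hy.1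

theorem fgmTolerance_nonneg (n T : ℕ) (α : ℝ) : 0 ≤ fgmTolerance n T α :=
  mul_nonneg (rpow_nonneg (log_natCast_nonneg n) _) (by positivity)

theorem fgmTolerance_pos (hn : 2 ≤ n) {T : ℕ} (hT : 1 ≤ T) : 0 < fgmTolerance n T α :=
  mul_pos (rpow_pos_of_pos (log_pos (by exact_mod_cast hn)) _)
    (rpow_pos_of_pos (by exact_mod_cast hT) _)

/-- This identity is what dictates the choice of tolerance: with β = 2α-1 it balances log n / A
against ε. -/
theorem log_eq_fgmTolerance_rpow (hα : 0 < α) {T : ℕ} (hT : 1 ≤ T) :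
    log n = fgmTolerance n T α ^ (1 + (2 * α - 1)) * (T : ℝ) ^ (2 - (2 * α - 1)) := by
  have hT0 : (0 : ℝ) < T := by exact_mod_cast hT
  have hl := log_natCast_nonneg n
  rw [fgmTolerance, mul_rpow (rpow_nonneg hl _) (by positivity), ← rpow_mul hl,
    ← rpow_mul hT0.le, mul_assoc, ← rpow_add hT0]
  have e1 : 0.5 / α * (1 + (2 * α - 1)) = 1 := by field_simp; ring
  have e2 : (1 - 1.5 / α) * (1 + (2 * α - 1)) + (2 - (2 * α - 1)) = 0 := by field_simp; ring
  rw [e1, e2, rpow_one, rpow_zero, mul_one]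

theorem subsingleton_stdSimplex_one {p q : Fin 1 → ℝ} (hp : p ∈ stdSimplex ℝ (Fin 1))
    (hq : q ∈ stdSimplex ℝ (Fin 1)) : p = q := by
  have h1 := hp.2
  have h2 := hq.2
  simp only [Finset.univ_unique, Fin.default_eq_zero, Finset.sum_singleton] at h1 h2
  funext j
  rw [Subsingleton.elim j 0, h1, h2]

theorem negRenyiInfo_eq (p : Fin n → ℝ) :
    negRenyiInfo α W p = α / (1 - α) * log (expRenyi α W p) := by
  rw [negRenyiInfo, petzRenyiInfo, ← neg_mul, ← div_neg, neg_sub]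
  rfl

theorem exists_isMinOn_expRenyi (hn : 1 ≤ n) (hα0 : 1 / 2 ≤ α) (hα1 : α < 1)
    (hW : ∀ j, IsDensityMatrix (W j)) :
    ∃ p ∈ stdSimplex ℝ (Fin n), IsMinOn (expRenyi α W) (stdSimplex ℝ (Fin n)) p := by
  have : NeZero n := ⟨by omega⟩
  refine (isCompact_stdSimplex ℝ (Fin n)).exists_isMinOn ⟨_, gibbs_mem 0⟩ fun x hx => ?_
  exact (hasFDerivWithinAt_expRenyi hα0 hα1 hW hx.1).continuousWithinAt.mono fun _ hp => hp.1

theorem isMinOn_negRenyiInfo (hα0 : 1 / 2 ≤ α) (hα1 : α < 1) (hW : ∀ j, IsDensityMatrix (W j))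
    {p : Fin n → ℝ} (hp : p ∈ stdSimplex ℝ (Fin n))
    (hmin : IsMinOn (expRenyi α W) (stdSimplex ℝ (Fin n)) p) :
    IsMinOn (negRenyiInfo α W) (stdSimplex ℝ (Fin n)) p := fun x hx => by
  rw [Set.mem_ofPred_eq, negRenyiInfo_eq, negRenyiInfo_eq]
  have h := log_le_log (expRenyi_pos (by linarith) hα1 hW hp) (hmin hx)
  exact mul_le_mul_of_nonneg_left h (div_nonneg (by linarith) (by linarith))

theorem negRenyiInfo_eq_min {p : Fin n → ℝ} (hp : p ∈ stdSimplex ℝ (Fin n))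
    (hmin : IsMinOn (negRenyiInfo α W) (stdSimplex ℝ (Fin n)) p) :
    negRenyiInfo α W p = minNegRenyiInfo α W :=
  (IsLeast.csInf_eq (s := negRenyiInfo α W '' stdSimplex ℝ (Fin n))
    ⟨⟨p, hp, rfl⟩, by rintro _ ⟨x, hx, rfl⟩; exact hmin hx⟩).symm

/-- Passing from the exponentiated objective to the Rényi information. -/
theorem negRenyiInfo_sub_le (hα0 : 1 / 2 ≤ α) (hα1 : α < 1) (hW : ∀ j, IsDensityMatrix (W j))
    {p q : Fin n → ℝ} (hp : p ∈ stdSimplex ℝ (Fin n)) (hq : q ∈ stdSimplex ℝ (Fin n)) {δ : ℝ}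
    (hδ : 0 ≤ δ) (h : expRenyi α W q - expRenyi α W p ≤ δ) :
    negRenyiInfo α W q - negRenyiInfo α W p ≤
      δ * exp ((1 / α - 1) * -negRenyiInfo α W p) / (1 - α) := by
  have hα : 0 < α := by linarith
  have h1α : 0 < 1 - α := by linarith
  have hfp := expRenyi_pos hα hα1 hW hp
  have hfq := expRenyi_pos hα hα1 hW hq
  -- The factors 1/α - 1 and α/(1-α) cancel, so the exponential is exactly the reciprocal of the
  -- objective.
  have he : exp ((1 / α - 1) * -negRenyiInfo α W p) = (expRenyi α W p)⁻¹ := by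
    rw [negRenyiInfo_eq, ← exp_log hfp, ← exp_neg, log_exp]
    congr 1
    field_simp
  have h1 : log (expRenyi α W q) - log (expRenyi α W p) ≤ δ * (expRenyi α W p)⁻¹ := by
    rw [← log_div hfq.ne' hfp.ne']
    refine (log_le_sub_one_of_pos (div_pos hfq hfp)).trans ?_
    rw [div_sub_one hfp.ne', div_eq_mul_inv]
    exact mul_le_mul_of_nonneg_right h (by positivity)
  rw [he, negRenyiInfo_eq, negRenyiInfo_eq, ← mul_sub, div_mul_eq_mul_div]
  refine div_le_div_of_nonneg_right ?_ h1α.le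
  calc α * (log (expRenyi α W q) - log (expRenyi α W p)) ≤ α * (δ * (expRenyi α W p)⁻¹) :=
        mul_le_mul_of_nonneg_left h1 hα.le
    _ ≤ δ * (expRenyi α W p)⁻¹ := mul_le_of_le_one_left (by positivity) hα1.le

theorem exists_accept_expRenyi [NeZero n] (hα0 : 1 / 2 ≤ α) (hα1 : α < 1)
    (hW : ∀ j, IsDensityMatrix (W j)) {T : ℕ} (hT : 1 ≤ T) {s : FGMState n}
    (hs : s.Invariant (expRenyi α W) (fgmTolerance n T α)) (c : Fin n → ℝ) :
    ∃ i, s.Accept (expRenyi α W) (fgmTolerance n T α) (gibbs c) i := by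
  have hn : 1 ≤ n := Nat.pos_of_ne_zero (NeZero.ne n)
  rcases hn.eq_or_lt with rfl | hn
  · refine ⟨0, ?_⟩
    have hx := FGMState.trialMid_mem hs.L_pos hs.A_nonneg hs.p_mem (gibbs_mem c) 0
    have hy := FGMState.trialNext_gibbs_mem (f := expRenyi α W) hs.L_pos hs.A_nonneg hs.p_mem c 0
    have hτ := FGMState.trialWeight_pos hs.L_pos hs.A_nonneg 0
    have hε := fgmTolerance_nonneg 1 T α
    unfold FGMState.Accept
    rw [subsingleton_stdSimplex_one hy hx, sub_self]
    simp only [dotProduct_zero, l1Norm, Pi.zero_apply, abs_zero, Finset.sum_const_zero]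
    have : 0 ≤ fgmTolerance 1 T α / 2 * s.trialWeight 0 := by positivity
    linarith
  · exact exists_accept (by linarith) (by linarith) (holderSmooth_expRenyi hα0 hα1 hW)
      (fgmTolerance_pos hn hT) hs.L_pos hs.A_nonneg hs.p_mem c

theorem IsFGMRun.expRenyi_sub_le [NeZero n] (hα0 : 1 / 2 ≤ α) (hα1 : α < 1)
    (hW : ∀ j, IsDensityMatrix (W j)) {T : ℕ} (hT : 1 ≤ T) {s : ℕ → FGMState n}
    (hrun : IsFGMRun (expRenyi α W) (fgmTolerance n T α) T s) {p : Fin n → ℝ}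
    (hp : p ∈ stdSimplex ℝ (Fin n)) :
    expRenyi α W (s (T + 1)).p - expRenyi α W p ≤ 9000 * fgmTolerance n T α := by
  have hα : 0 < α := by linarith
  have hf := holderSmooth_expRenyi hα0 hα1 hW
  have hmem := (hrun.invariant hf (t := T + 1) (by omega) le_rfl).p_mem
  have hε := fgmTolerance_nonneg n T α
  have hn : 1 ≤ n := Nat.pos_of_ne_zero (NeZero.ne n)
  rcases hn.eq_or_lt with rfl | hn
  · rw [subsingleton_stdSimplex_one hmem hp]
    linarith
  -- For ε ≥ 1 the claim is trivial because the objective takes values in (0,1] on the simplex.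
  rcases le_total (fgmTolerance n T α) 1 with h | h
  · exact hrun.error_le (by linarith) (by linarith) hf (fgmTolerance_pos hn hT) h hT
      (log_eq_fgmTolerance_rpow hα hT).le hp
  · linarith [expRenyi_le_one hα hα1 hW hmem, expRenyi_pos hα hα1 hW hp]

end MainTheorem

theorem mainTheorem3 :
    ∃ K : ℝ, 0 < K ∧
      ∀ (n d : ℕ), 1 ≤ n →
      ∀ (W : Fin n → Matrix (Fin d) (Fin d) ℂ), (∀ j, IsDensityMatrix (W j)) →
      ∀ (α : ℝ), 1 / 2 ≤ α → α < 1 →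
      ∀ (T : ℕ), 1 ≤ T →
        -- the gradients used by the method exist and the minimum is attained
        (∀ p ∈ stdSimplex ℝ (Fin n), DifferentiableWithinAt ℝ (expRenyi α W) (Set.Ici 0) p) ∧
        (∃ p ∈ stdSimplex ℝ (Fin n), negRenyiInfo α W p = minNegRenyiInfo α W ∧
          IsMinOn (negRenyiInfo α W) (stdSimplex ℝ (Fin n)) p) ∧
        -- the method is well defined, and every run of it satisfies the error bound
        (∃ s : ℕ → FGMState n, IsFGMRun (expRenyi α W) (fgmTolerance n T α) T s) ∧
        ∀ s : ℕ → FGMState n, IsFGMRun (expRenyi α W) (fgmTolerance n T α) T s →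
          (s (T + 1)).p ∈ stdSimplex ℝ (Fin n) ∧
          ∃ C : ℝ,
            C ≤ K * (log n ^ (0.5 / α) * exp ((1 / α - 1) * capacity α W) / (1 - α)) ∧
            negRenyiInfo α W (s (T + 1)).p - minNegRenyiInfo α W
              ≤ C * (T : ℝ) ^ (1 - 1.5 / α) := by

  refine ⟨9000, by norm_num, fun n d hn W hW α hα0 hα1 T hT => ?_⟩
  have : NeZero n := ⟨by omega⟩
  have hf := holderSmooth_expRenyi hα0 hα1 hW
  obtain ⟨p, hp, hmin⟩ := exists_isMinOn_expRenyi hn hα0 hα1 hW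
  have hming := isMinOn_negRenyiInfo hα0 hα1 hW hp hmin
  have heq := negRenyiInfo_eq_min hp hming
  refine ⟨fun x hx => (hasFDerivWithinAt_expRenyi hα0 hα1 hW hx.1).differentiableWithinAt,
    ⟨p, hp, heq, hming⟩,
    exists_isFGMRun hf (fun s hs c => exists_accept_expRenyi hα0 hα1 hW hT hs c) T,
    fun s hrun => ?_⟩
  have hmem := (hrun.invariant hf (t := T + 1) (by omega) le_rfl).p_mem
  -- The witness `C` is the full bound itself, with K = 9000.
  refine ⟨hmem, _, le_rfl, ?_⟩
  have h := negRenyiInfo_sub_le hα0 hα1 hW hp hmem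
    (mul_nonneg (by norm_num) (fgmTolerance_nonneg n T α))
    (hrun.expRenyi_sub_le hα0 hα1 hW hT hp)
  rw [heq] at h
  refine h.trans_eq ?_
  rw [fgmTolerance, capacity]
  ring
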